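/- Let $\mathbb{C}_q=\mathbb{C}(q)$ and let $m\ge 1$. Let $U_q(\mathfrak{gl}_m)$ be the $\mathbb{C}_q$-algebra generated by $E_i,F_i$ $(1\le i\le m-1)$ and $L_j^{\pm1}$ $(1\le j\le m)$, with relations: the $L_j$ are invertible and commute; $L_jE_i=q^{\delta_{j,i}-\delta_{j,i+1}}E_iL_j$, $L_jF_i=q^{-\delta_{j,i}+\delta_{j,i+1}}F_iL_j$; $E_iF_j-F_jE_i=\delta_{ij}\frac{K_i-K_i^{-1}}{q-q^{-1}}$ with $K_i=L_iL_{i+1}^{-1}$; $E_iE_j=E_jE_i$, $F_iF_j=F_jF_i$ for $|i-j|\ge2$; and $E_i^2E_j-(q+q^{-1})E_iE_jE_i+E_jE_i^2=0$, $F_i^2F_j-(q+q^{-1})F_iF_jF_i+F_jF_i^2=0$ for $|i-j|=1$. Tensor products, duals and the trivial representation $\mathbb{C}_q$ are formed with $\Delta(E_i)=E_i\otimes K_i^{-1}+1\otimes E_i$, $\Delta(F_i)=F_i\otimes 1+K_i\otimes F_i$, $\Delta(L_j)=L_j\otimes L_j$; $S(E_i)=-E_iK_i$, $S(F_i)=-K_i^{-1}F_i$,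 $S(L_j)=L_j^{-1}$ (an anti-homomorphism, acting on a dual by $(xf)(v)=f(S(x)v)$); and counit $E_i,F_i\mapsto0$, $L_j\mapsto1$. Let $U_q(\mathfrak{sl}_m)\subset U_q(\mathfrak{gl}_m)$ be the subalgebra generated by the $E_i,F_i,K_i^{\pm1}$. Let $V=\mathbb{C}_q^m$ be the vector representation, with basis $x_1,\dots,x_m$, $E_ix_j=\delta_{i+1,j}x_i$, $F_ix_j=\delta_{i,j}x_{i+1}$, $L_jx_i=q^{\delta_{ij}}x_i$. Let $I\subset V\otimes V$ be spanned by the $x_i\otimes x_i$ and the $x_i\otimes x_j+q^{-1}x_j\otimes x_i$ $(i<j)$, and let $\bigwedge_q^l(V)$ be the quotient of $V^{\otimes l}$ by $\sum_{0\le s\le l-2}V^{\otimes s}\otimes I\otimes V^{\otimes(l-s-2)}$. **Lemma.** As representations of $U_q(\mathfrak{sl}_m)$, $$\textstyle\bigwedge_q^m(V)\simeq\mathbb{C}_q\qquad\text{and}\qquad\bigwedge_q^{m-1}(V)\simeq V^*.$$ The duality is realized by the natural projection $p:V\otimes\bigwedge_q^{m-1}(V)\to\bigwedge_q^m(V)$,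 $v\otimes[t]\mapsto[v\otimes t]$, in the following sense. The map $p$ is a surjective homomorphism of $U_q(\mathfrak{sl}_m)$-representations, and for every isomorphism $\varphi:\bigwedge_q^m(V)\to\mathbb{C}_q$ of $U_q(\mathfrak{sl}_m)$-representations: 1. $v\mapsto\varphi(p(v\otimes -))$ is an isomorphism $V\to\bigl(\bigwedge_q^{m-1}(V)\bigr)^*$ of $U_q(\mathfrak{sl}_m)$-representations; 2. there is an isomorphism $\psi:\bigwedge_q^{m-1}(V)\to V^*$ of $U_q(\mathfrak{sl}_m)$-representations with $\varphi\circ p=\mathrm{cap}\circ(\mathrm{id}_V\otimes\psi)$, where $\mathrm{cap}:V\otimes V^*\to\mathbb{C}_q$ is the duality pairing $x_k\otimes f\mapsto q^{2k-m-1}f(x_k)$. -/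

import Mathlib

open scoped TensorProduct

set_option linter.unusedSimpArgs false
set_option linter.unnecessarySeqFocus false

noncomputable section

namespace QuantumGl

/-! ### Ground field -/

/-- The ground field `ℂ(q)`, also written `ℂ_q`. -/
abbrev Cq : Type := RatFunc ℂ

/-- The quantum parameter. -/
def q : Cq := RatFunc.X

theorem q_ne_zero : q ≠ 0 := RatFunc.X_ne_zero

/-! ### The quantum enveloping algebra of `gl_m`

Throughout `m = r + 1`, so that `m` runs over the positive integers. The simple root vectors are
indexed by `i : Fin r` and the Cartan generators by `j : Fin (r + 1)`; the two Cartan indices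
attached to the simple root `i` are `i.castSucc` (the index `i`) and `i.succ` (the index `i + 1`).
-/

/-- Generators of `U_q(gl_{r+1})`: `E_i`, `F_i`, `L_j` and the inverses `L_j⁻¹`. -/
inductive Gen (r : ℕ) : Type
  | E (i : Fin r) : Gen r
  | F (i : Fin r) : Gen r
  | L (j : Fin (r + 1)) : Gen r
  | Linv (j : Fin (r + 1)) : Gen r

/-- `wt j i` is `1` if `j = i`, `-1` if `j = i + 1` and `0` otherwise. -/
def wt {r : ℕ} (j : Fin (r + 1)) (i : Fin r) : ℤ :=
  if j = i.castSucc then 1 else if j = i.succ then -1 else 0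

/-- The defining relations of `U_q(gl_{r+1})`, written for elements `E_i`, `F_i`, `L_j`, `L_j⁻¹` of
an arbitrary algebra `A`: `Rel E F L Linv x y` says that `x = y` is one of these relations. -/
inductive Rel {r : ℕ} {A : Type} [Ring A] [Algebra Cq A] (E F : Fin r → A)
    (L Linv : Fin (r + 1) → A) : A → A → Prop
  | L_Linv (j) : Rel E F L Linv (L j * Linv j) 1
  | Linv_L (j) : Rel E F L Linv (Linv j * L j) 1
  | L_comm (j k) : Rel E F L Linv (L j * L k) (L k * L j)
  | L_E (j i) : Rel E F L Linv (L j * E i) (q ^ wt j i • (E i * L j))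
  | L_F (j i) : Rel E F L Linv (L j * F i) (q ^ (-wt j i) • (F i * L j))
  | E_F (i) : Rel E F L Linv (E i * F i - F i * E i)
      ((q - q⁻¹)⁻¹ • (L i.castSucc * Linv i.succ - Linv i.castSucc * L i.succ))
  | E_F_ne (i j) : i ≠ j → Rel E F L Linv (E i * F j) (F j * E i)
  | E_far (i j : Fin r) : (i : ℕ) + 2 ≤ j → Rel E F L Linv (E i * E j) (E j * E i)
  | F_far (i j : Fin r) : (i : ℕ) + 2 ≤ j → Rel E F L Linv (F i * F j) (F j * F i)
  | E_serre (i j : Fin r) : (i : ℕ) + 1 = j ∨ (j : ℕ) + 1 = i → Rel E F L Linv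
      (E i * E i * E j - (q + q⁻¹) • (E i * E j * E i) + E j * E i * E i) 0
  | F_serre (i j : Fin r) : (i : ℕ) + 1 = j ∨ (j : ℕ) + 1 = i → Rel E F L Linv
      (F i * F i * F j - (q + q⁻¹) • (F i * F j * F i) + F j * F i * F i) 0

/-- The quantum enveloping algebra `U_q(gl_{r+1})`. -/
def Uqgl (r : ℕ) : Type :=
  RingQuot (Rel (fun i => FreeAlgebra.ι Cq (Gen.E i)) (fun i => FreeAlgebra.ι Cq (Gen.F i))
    (fun j => FreeAlgebra.ι Cq (Gen.L j)) (fun j => FreeAlgebra.ι Cq (Gen.Linv (r := r) j)))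

instance (r : ℕ) : Ring (Uqgl r) := inferInstanceAs (Ring (RingQuot _))

instance (r : ℕ) : Algebra Cq (Uqgl r) := inferInstanceAs (Algebra Cq (RingQuot _))

/-- The quotient map from the free algebra on the generators to `U_q(gl_{r+1})`. -/
def mk (r : ℕ) : FreeAlgebra Cq (Gen r) →ₐ[Cq] Uqgl r := RingQuot.mkAlgHom Cq _

/-- The class of a generator in `U_q(gl_{r+1})`. -/
def gen {r : ℕ} (g : Gen r) : Uqgl r := mk r (FreeAlgebra.ι Cq g)

/-- The generator `E_i`. -/
abbrev E {r : ℕ} (i : Fin r) : Uqgl r := gen (Gen.E i)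

/-- The generator `F_i`. -/
abbrev F {r : ℕ} (i : Fin r) : Uqgl r := gen (Gen.F i)

/-- The generator `L_j`. -/
abbrev L {r : ℕ} (j : Fin (r + 1)) : Uqgl r := gen (Gen.L j)

/-- The inverse of the generator `L_j`. -/
abbrev Linv {r : ℕ} (j : Fin (r + 1)) : Uqgl r := gen (Gen.Linv j)

/-- `K_i = L_i L_{i+1}⁻¹`. -/
def K {r : ℕ} (i : Fin r) : Uqgl r := L i.castSucc * Linv i.succ

/-- `K_i⁻¹ = L_i⁻¹ L_{i+1}`. -/
def Kinv {r : ℕ} (i : Fin r) : Uqgl r := Linv i.castSucc * L i.succ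

section lift

variable {r : ℕ} {A B : Type} [Ring A] [Algebra Cq A] [Ring B] [Algebra Cq B]

theorem Rel.map {E F : Fin r → A} {L Linv : Fin (r + 1) → A} (f : A →ₐ[Cq] B) {x y : A}
    (h : Rel E F L Linv x y) :
    Rel (fun i => f (E i)) (fun i => f (F i)) (fun j => f (L j)) (fun j => f (Linv j))
      (f x) (f y) := by
  cases h <;> simp only [map_mul, map_sub, map_add, map_smul, map_one, map_zero]
  · exact .L_Linv _
  · exact .Linv_L _
  · exact .L_comm _ _
  · exact .L_E _ _
  · exact .L_F _ _
  · exact .E_F _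
  · exact .E_F_ne _ _ ‹_›
  · exact .E_far _ _ ‹_›
  · exact .F_far _ _ ‹_›
  · exact .E_serre _ _ ‹_›
  · exact .F_serre _ _ ‹_›

theorem mk_rel {x y : FreeAlgebra Cq (Gen r)}
    (h : Rel (fun i => FreeAlgebra.ι Cq (Gen.E i)) (fun i => FreeAlgebra.ι Cq (Gen.F i))
      (fun j => FreeAlgebra.ι Cq (Gen.L j)) (fun j => FreeAlgebra.ι Cq (Gen.Linv (r := r) j)) x y) :
    mk r x = mk r y :=
  RingQuot.mkAlgHom_rel Cq h

theorem rel {x y : Uqgl r} (h : Rel E F L Linv x y) : x = y := by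
  cases h
  · simpa only [gen, map_mul, map_one] using mk_rel (.L_Linv _)
  · simpa only [gen, map_mul, map_one] using mk_rel (.Linv_L _)
  · simpa only [gen, map_mul] using mk_rel (.L_comm _ _)
  · simpa only [gen, map_mul, map_smul] using mk_rel (.L_E _ _)
  · simpa only [gen, map_mul, map_smul] using mk_rel (.L_F _ _)
  · simpa only [gen, map_mul, map_smul, map_sub] using mk_rel (.E_F _)
  · simpa only [gen, map_mul] using mk_rel (.E_F_ne _ _ ‹_›)
  · simpa only [gen, map_mul] using mk_rel (.E_far _ _ ‹_›)
  · simpa only [gen, map_mul] using mk_rel (.F_far _ _ ‹_›)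
  · simpa only [gen, map_mul, map_smul, map_sub, map_add, map_zero] using mk_rel (.E_serre _ _ ‹_›)
  · simpa only [gen, map_mul, map_smul, map_sub, map_add, map_zero] using mk_rel (.F_serre _ _ ‹_›)

/-- The value on generators of an algebra homomorphism out of `U_q(gl_{r+1})`. -/
def genMap (E F : Fin r → A) (L Linv : Fin (r + 1) → A) : Gen r → A
  | .E i => E i
  | .F i => F i
  | .L j => L j
  | .Linv j => Linv j

/-- The algebra homomorphism out of `U_q(gl_{r+1})` with prescribed values on the generators. -/
def lift (E F : Fin r → A) (L Linv : Fin (r + 1) → A)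
    (h : ∀ x y, Rel E F L Linv x y → x = y) : Uqgl r →ₐ[Cq] A :=
  RingQuot.liftAlgHom Cq ⟨FreeAlgebra.lift Cq (genMap E F L Linv), fun x y hxy => by
    refine h _ _ ?_
    simpa only [FreeAlgebra.lift_ι_apply, genMap] using hxy.map
      (FreeAlgebra.lift Cq (genMap E F L Linv))⟩

theorem lift_gen (E F : Fin r → A) (L Linv : Fin (r + 1) → A)
    (h : ∀ x y, Rel E F L Linv x y → x = y) (g : Gen r) :
    lift E F L Linv h (gen g) = genMap E F L Linv g := by
  unfold lift gen mk
  exact (RingQuot.liftAlgHom_mkAlgHom_apply _ _ _ _).trans (FreeAlgebra.lift_ι_apply _ _)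

end lift

/-! ### Commutation rules -/

section rules

variable {r : ℕ}

/-- The entries of the Cartan matrix. -/
def cm (i j : Fin r) : ℤ := wt i.castSucc j - wt i.succ j

theorem cm_self (i : Fin r) : cm i i = 2 := by
  have h : i.succ ≠ i.castSucc := by simp [Fin.ext_iff]
  simp [cm, wt, h]

theorem cm_adj {i j : Fin r} (h : (i : ℕ) + 1 = j ∨ (j : ℕ) + 1 = i) : cm i j = -1 := by
  simp only [cm, wt, Fin.ext_iff, Fin.val_succ, Fin.val_castSucc]
  split_ifs <;> omega

theorem cm_far {i j : Fin r} (h : (i : ℕ) + 2 ≤ j ∨ (j : ℕ) + 2 ≤ i) : cm i j = 0 := by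
  simp only [cm, wt, Fin.ext_iff, Fin.val_succ, Fin.val_castSucc]
  split_ifs <;> omega

theorem cm_symm (i j : Fin r) : cm i j = cm j i := by
  simp only [cm, wt, Fin.ext_iff, Fin.val_succ, Fin.val_castSucc]
  split_ifs <;> omega

theorem L_mul_Linv (j : Fin (r + 1)) : L j * Linv j = 1 := rel (.L_Linv j)

theorem Linv_mul_L (j : Fin (r + 1)) : Linv j * L j = 1 := rel (.Linv_L j)

theorem L_comm (j k : Fin (r + 1)) : Commute (L j) (L k) := rel (.L_comm j k)

/-- `L_j` as a unit. -/
def Lu (j : Fin (r + 1)) : (Uqgl r)ˣ := ⟨L j, Linv j, L_mul_Linv j, Linv_mul_L j⟩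

theorem L_Linv_comm (j k : Fin (r + 1)) : Commute (L j) (Linv k) :=
  Commute.units_inv_right (u := Lu k) (L_comm j k)

theorem Linv_comm (j k : Fin (r + 1)) : Commute (Linv j) (Linv k) :=
  Commute.units_inv_left (u := Lu j) (L_Linv_comm j k)

theorem inv_rule {A : Type} [Ring A] [Algebra Cq A] {l l' x : A} {n : ℤ} (h1 : l * l' = 1)
    (h2 : l' * l = 1) (h : l * x = q ^ n • (x * l)) : l' * x = q ^ (-n) • (x * l') := by
  have h3 : l' * (l * x) * l' = x * l' := by rw [← mul_assoc, h2, one_mul]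
  rw [h, mul_smul_comm, smul_mul_assoc, mul_assoc, mul_assoc, h1, mul_one] at h3
  rw [← h3, smul_smul, ← zpow_add₀ q_ne_zero]
  simp

theorem mul_rule {A : Type} [Ring A] [Algebra Cq A] {l k x : A} {m n : ℤ}
    (hl : l * x = q ^ m • (x * l)) (hk : k * x = q ^ n • (x * k)) :
    l * k * x = q ^ (m + n) • (x * (l * k)) := by
  rw [mul_assoc, hk, mul_smul_comm, ← mul_assoc, hl, smul_mul_assoc, smul_smul, mul_assoc,
    ← zpow_add₀ q_ne_zero, add_comm]

theorem L_E (j : Fin (r + 1)) (i : Fin r) : L j * E i = q ^ wt j i • (E i * L j) :=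
  rel (.L_E j i)

theorem L_F (j : Fin (r + 1)) (i : Fin r) : L j * F i = q ^ (-wt j i) • (F i * L j) :=
  rel (.L_F j i)

theorem Linv_E (j : Fin (r + 1)) (i : Fin r) : Linv j * E i = q ^ (-wt j i) • (E i * Linv j) :=
  inv_rule (L_mul_Linv j) (Linv_mul_L j) (L_E j i)

theorem Linv_F (j : Fin (r + 1)) (i : Fin r) : Linv j * F i = q ^ wt j i • (F i * Linv j) := by
  simpa using inv_rule (L_mul_Linv j) (Linv_mul_L j) (L_F j i)

theorem K_E (i j : Fin r) : K i * E j = q ^ cm i j • (E j * K i) := by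
  simpa only [sub_eq_add_neg, cm, K] using mul_rule (L_E i.castSucc j) (Linv_E i.succ j)

theorem K_F (i j : Fin r) : K i * F j = q ^ (-cm i j) • (F j * K i) := by
  have := mul_rule (L_F i.castSucc j) (Linv_F i.succ j)
  rwa [show -wt i.castSucc j + wt i.succ j = -cm i j by rw [cm]; ring] at this

theorem Kinv_E (i j : Fin r) : Kinv i * E j = q ^ (-cm i j) • (E j * Kinv i) := by
  have := mul_rule (Linv_E i.castSucc j) (L_E i.succ j)
  rwa [show -wt i.castSucc j + wt i.succ j = -cm i j by rw [cm]; ring] at this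

theorem Kinv_F (i j : Fin r) : Kinv i * F j = q ^ cm i j • (F j * Kinv i) := by
  simpa only [sub_eq_add_neg, cm, Kinv] using mul_rule (Linv_F i.castSucc j) (L_F i.succ j)

theorem L_K_comm (j : Fin (r + 1)) (i : Fin r) : Commute (L j) (K i) :=
  (L_comm _ _).mul_right (L_Linv_comm _ _)

theorem L_Kinv_comm (j : Fin (r + 1)) (i : Fin r) : Commute (L j) (Kinv i) :=
  (L_Linv_comm _ _).mul_right (L_comm _ _)

theorem Linv_K_comm (j : Fin (r + 1)) (i : Fin r) : Commute (Linv j) (K i) :=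
  (L_Linv_comm _ _).symm.mul_right (Linv_comm _ _)

theorem Linv_Kinv_comm (j : Fin (r + 1)) (i : Fin r) : Commute (Linv j) (Kinv i) :=
  (Linv_comm _ _).mul_right (L_Linv_comm _ _).symm

theorem K_comm (i j : Fin r) : Commute (K i) (K j) :=
  (L_K_comm _ _).mul_left (Linv_K_comm _ _)

theorem Kinv_comm (i j : Fin r) : Commute (Kinv i) (Kinv j) :=
  (Linv_Kinv_comm _ _).mul_left (L_Kinv_comm _ _)

theorem K_Kinv_comm (i j : Fin r) : Commute (K i) (Kinv j) :=
  (L_Kinv_comm _ _).mul_left (Linv_Kinv_comm _ _)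

theorem K_mul_Kinv (i : Fin r) : K i * Kinv i = 1 := by
  rw [K, Kinv, mul_assoc, ← mul_assoc (Linv i.succ), (Linv_comm _ _).eq, mul_assoc, Linv_mul_L,
    mul_one, L_mul_Linv]

theorem Kinv_mul_K (i : Fin r) : Kinv i * K i = 1 := by
  rw [← (K_Kinv_comm i i).eq, K_mul_Kinv]

theorem E_F (i : Fin r) : E i * F i - F i * E i = (q - q⁻¹)⁻¹ • (K i - Kinv i) := rel (.E_F i)

/-- The quantum Serre expression is additive along `q`-commuting decompositions. -/
theorem serre_add {k A : Type} [Field k] [Ring A] [Algebra k A] {q : k} (q0 : q ≠ 0)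
    {a b c d : A}
    (hac : a * a * c - (q + q⁻¹) • (a * c * a) + c * a * a = 0)
    (hbd : b * b * d - (q + q⁻¹) • (b * d * b) + d * b * b = 0)
    (hab : a * b = q ^ (-2 : ℤ) • (b * a)) (had : a * d = q • (d * a)) (hcb : c * b = q • (b * c)) :
    (a + b) * (a + b) * (c + d) - (q + q⁻¹) • ((a + b) * (c + d) * (a + b))
      + (c + d) * (a + b) * (a + b) = 0 := by
  have hab' (x : A) : a * (b * x) = q ^ (-2 : ℤ) • (b * (a * x)) := by
    rw [← mul_assoc, hab, smul_mul_assoc, mul_assoc]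
  have had' (x : A) : a * (d * x) = q • (d * (a * x)) := by
    rw [← mul_assoc, had, smul_mul_assoc, mul_assoc]
  have hcb' (x : A) : c * (b * x) = q • (b * (c * x)) := by
    rw [← mul_assoc, hcb, smul_mul_assoc, mul_assoc]
  have e1 : a * a * d - (q + q⁻¹) • (a * d * a) + d * a * a = 0 := by
    simp only [mul_assoc, had, had', mul_smul_comm, smul_mul_assoc, smul_smul]
    match_scalars <;> field_simp <;> ring
  have e2 : b * b * c - (q + q⁻¹) • (b * c * b) + c * b * b = 0 := by
    simp only [mul_assoc, hcb, hcb', mul_smul_comm, smul_mul_assoc, smul_smul]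
    match_scalars <;> field_simp <;> ring
  have e3 : a * b * c + b * a * c - (q + q⁻¹) • (a * c * b + b * c * a)
      + (c * a * b + c * b * a) = 0 := by
    simp only [mul_assoc, hcb, hcb', hab, hab', mul_smul_comm, smul_mul_assoc, smul_smul, smul_add]
    match_scalars <;> field_simp <;> ring
  have e4 : a * b * d + b * a * d - (q + q⁻¹) • (a * d * b + b * d * a)
      + (d * a * b + d * b * a) = 0 := by
    simp only [mul_assoc, had, had', hab, hab', mul_smul_comm, smul_mul_assoc, smul_smul, smul_add]
    match_scalars <;> field_simp <;> ring
  have e := congr($hac + $hbd + $e1 + $e2 + $e3 + $e4)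
  simp only [add_zero] at e
  rw [← e]
  simp only [mul_add, add_mul, smul_add]
  abel

/-- The quantum Serre relation is stable under twisting by `q`-commuting Cartan elements. -/
theorem serre_twist {k A : Type} [Field k] [Ring A] [Algebra k A] {q : k}
    {e f g l : A} {n : ℤ}
    (hef : e * e * f - (q + q⁻¹) • (e * f * e) + f * e * e = 0) (hkl : g * l = l * g)
    (hke : g * e = q ^ (2 : ℤ) • (e * g)) (hkf : g * f = q ^ n • (f * g))
    (hle : l * e = q ^ n • (e * l)) :
    (e * g) * (e * g) * (f * l) - (q + q⁻¹) • ((e * g) * (f * l) * (e * g))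
      + (f * l) * (e * g) * (e * g) = 0 := by
  have hke' (x : A) : g * (e * x) = q ^ (2 : ℤ) • (e * (g * x)) := by
    rw [← mul_assoc, hke, smul_mul_assoc, mul_assoc]
  have hkf' (x : A) : g * (f * x) = q ^ n • (f * (g * x)) := by
    rw [← mul_assoc, hkf, smul_mul_assoc, mul_assoc]
  have hle' (x : A) : l * (e * x) = q ^ n • (e * (l * x)) := by
    rw [← mul_assoc, hle, smul_mul_assoc, mul_assoc]
  have hkl' (x : A) : g * (l * x) = l * (g * x) := by
    rw [← mul_assoc, hkl, mul_assoc]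
  have e := congr(q ^ (2 : ℤ) • q ^ n • q ^ n • ($hef * (l * (g * g))))
  simp only [zero_mul, smul_zero] at e
  rw [← e]
  simp only [mul_add, add_mul, sub_mul, mul_assoc, hke', hkf', hle', hkl, hkl', mul_smul_comm,
    smul_mul_assoc, smul_smul, smul_add, smul_sub]
  match_scalars <;> ring

end rules

/-! ### Hopf structure -/

section hopf

variable {r : ℕ}

theorem serre_tmul {A B : Type} [Ring A] [Algebra Cq A] [Ring B] [Algebra Cq B] {e f : A} {k l : B}
    (h : e * e * f - (q + q⁻¹) • (e * f * e) + f * e * e = 0) (hkl : k * l = l * k) :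
    (e ⊗ₜ[Cq] k) * (e ⊗ₜ[Cq] k) * (f ⊗ₜ[Cq] l)
      - (q + q⁻¹) • ((e ⊗ₜ[Cq] k) * (f ⊗ₜ[Cq] l) * (e ⊗ₜ[Cq] k))
      + (f ⊗ₜ[Cq] l) * (e ⊗ₜ[Cq] k) * (e ⊗ₜ[Cq] k) = 0 := by
  have h1 : k * l * k = k * k * l := by rw [mul_assoc, ← hkl, mul_assoc]
  have h2 : l * k * k = k * k * l := by rw [← hkl, h1]
  simp only [Algebra.TensorProduct.tmul_mul_tmul, h1, h2, TensorProduct.smul_tmul']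
  rw [← TensorProduct.sub_tmul, ← TensorProduct.add_tmul, h, TensorProduct.zero_tmul]

theorem serre_tmul' {A B : Type} [Ring A] [Algebra Cq A] [Ring B] [Algebra Cq B] {e f : B} {k l : A}
    (h : e * e * f - (q + q⁻¹) • (e * f * e) + f * e * e = 0) (hkl : k * l = l * k) :
    (k ⊗ₜ[Cq] e) * (k ⊗ₜ[Cq] e) * (l ⊗ₜ[Cq] f)
      - (q + q⁻¹) • ((k ⊗ₜ[Cq] e) * (l ⊗ₜ[Cq] f) * (k ⊗ₜ[Cq] e))
      + (l ⊗ₜ[Cq] f) * (k ⊗ₜ[Cq] e) * (k ⊗ₜ[Cq] e) = 0 := by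
  have h1 : k * l * k = k * k * l := by rw [mul_assoc, ← hkl, mul_assoc]
  have h2 : l * k * k = k * k * l := by rw [← hkl, h1]
  simp only [Algebra.TensorProduct.tmul_mul_tmul, h1, h2, ← TensorProduct.tmul_smul]
  rw [← TensorProduct.tmul_sub, ← TensorProduct.tmul_add, h, TensorProduct.tmul_zero]

/-- The comultiplication: `Δ(E_i) = E_i ⊗ K_i⁻¹ + 1 ⊗ E_i`, `Δ(F_i) = F_i ⊗ 1 + K_i ⊗ F_i`,
`Δ(L_j) = L_j ⊗ L_j`. -/
def comul (r : ℕ) : Uqgl r →ₐ[Cq] Uqgl r ⊗[Cq] Uqgl r :=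
  lift (fun i => E i ⊗ₜ Kinv i + 1 ⊗ₜ E i) (fun i => F i ⊗ₜ 1 + K i ⊗ₜ F i)
    (fun j => L j ⊗ₜ L j) (fun j => Linv j ⊗ₜ Linv j) (by
      intro x y h
      cases h with
      | L_Linv j =>
        simp only [Algebra.TensorProduct.tmul_mul_tmul, L_mul_Linv, Algebra.TensorProduct.one_def]
      | Linv_L j =>
        simp only [Algebra.TensorProduct.tmul_mul_tmul, Linv_mul_L, Algebra.TensorProduct.one_def]
      | L_comm j k => simp only [Algebra.TensorProduct.tmul_mul_tmul, (L_comm j k).eq]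
      | L_E j i =>
        simp only [mul_add, add_mul, Algebra.TensorProduct.tmul_mul_tmul, L_E, (L_Kinv_comm j i).eq,
          one_mul, mul_one, TensorProduct.smul_tmul', TensorProduct.tmul_smul, smul_add]
      | L_F j i =>
        simp only [mul_add, add_mul, Algebra.TensorProduct.tmul_mul_tmul, L_F, (L_K_comm j i).eq,
          one_mul, mul_one, TensorProduct.smul_tmul', TensorProduct.tmul_smul, smul_add]
      | E_F i =>
        have h := E_F i
        have h1 : (E i * K i) ⊗ₜ[Cq] (Kinv i * F i) = (K i * E i) ⊗ₜ[Cq] (F i * Kinv i) := by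
          rw [K_E, Kinv_F, TensorProduct.tmul_smul, TensorProduct.smul_tmul']
        have h2 : E i * F i = F i * E i + (q - q⁻¹)⁻¹ • (K i - Kinv i) := by rw [← h]; abel
        change _ = (q - q⁻¹)⁻¹ • ((L i.castSucc ⊗ₜ[Cq] L i.castSucc) * (Linv i.succ ⊗ₜ Linv i.succ) -
          (Linv i.castSucc ⊗ₜ Linv i.castSucc) * (L i.succ ⊗ₜ L i.succ))
        have h3 : (L i.castSucc ⊗ₜ[Cq] L i.castSucc) * (Linv i.succ ⊗ₜ Linv i.succ) =
          K i ⊗ₜ K i := Algebra.TensorProduct.tmul_mul_tmul _ _ _ _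
        have h4 : (Linv i.castSucc ⊗ₜ[Cq] Linv i.castSucc) * (L i.succ ⊗ₜ L i.succ) =
          Kinv i ⊗ₜ Kinv i := Algebra.TensorProduct.tmul_mul_tmul _ _ _ _
        rw [h3, h4]
        simp only [mul_add, add_mul, Algebra.TensorProduct.tmul_mul_tmul, one_mul, mul_one, h1, h2,
          TensorProduct.add_tmul, TensorProduct.tmul_add, ← TensorProduct.smul_tmul',
          TensorProduct.tmul_smul, TensorProduct.sub_tmul, TensorProduct.tmul_sub, smul_sub]
        abel
      | E_F_ne i j hij =>
        have h := rel (.E_F_ne i j hij)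
        have h1 : (E i * K j) ⊗ₜ[Cq] (Kinv i * F j) = (K j * E i) ⊗ₜ[Cq] (F j * Kinv i) := by
          rw [K_E, Kinv_F, TensorProduct.tmul_smul, TensorProduct.smul_tmul', cm_symm]
        simp only [mul_add, add_mul, Algebra.TensorProduct.tmul_mul_tmul, one_mul, mul_one, h1, h]
        abel
      | E_far i j hij =>
        have h := rel (.E_far i j hij)
        have h1 : Kinv i * E j = E j * Kinv i := by simp [Kinv_E, cm_far (.inl hij)]
        have h2 : Kinv j * E i = E i * Kinv j := by simp [Kinv_E, cm_far (.inr hij)]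
        simp only [mul_add, add_mul, Algebra.TensorProduct.tmul_mul_tmul, one_mul, mul_one, h1, h2,
          h, (Kinv_comm i j).eq]
        abel
      | F_far i j hij =>
        have h := rel (.F_far i j hij)
        have h1 : K i * F j = F j * K i := by simp [K_F, cm_far (.inl hij)]
        have h2 : K j * F i = F i * K j := by simp [K_F, cm_far (.inr hij)]
        simp only [mul_add, add_mul, Algebra.TensorProduct.tmul_mul_tmul, one_mul, mul_one, h1, h2,
          h, (K_comm i j).eq]
        abel
      | E_serre i j hij =>
        have h := rel (.E_serre i j hij)
        refine serre_add q_ne_zero (serre_tmul h (Kinv_comm i j).eq) (serre_tmul' h rfl) ?_ ?_ ?_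
        · simp only [Algebra.TensorProduct.tmul_mul_tmul, one_mul, mul_one, Kinv_E, cm_self,
            TensorProduct.tmul_smul]
        · simp only [Algebra.TensorProduct.tmul_mul_tmul, one_mul, mul_one, Kinv_E, cm_adj hij,
            TensorProduct.tmul_smul, neg_neg, zpow_one]
        · simp only [Algebra.TensorProduct.tmul_mul_tmul, one_mul, mul_one, Kinv_E,
            cm_adj hij.symm, TensorProduct.tmul_smul, neg_neg, zpow_one]
      | F_serre i j hij =>
        have h := rel (.F_serre i j hij)
        rw [add_comm (F i ⊗ₜ[Cq] 1), add_comm (F j ⊗ₜ[Cq] 1)]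
        refine serre_add q_ne_zero (serre_tmul' h (K_comm i j).eq) (serre_tmul h rfl) ?_ ?_ ?_
        · simp only [Algebra.TensorProduct.tmul_mul_tmul, one_mul, mul_one, K_F, cm_self,
            TensorProduct.smul_tmul']
        · simp only [Algebra.TensorProduct.tmul_mul_tmul, one_mul, mul_one, K_F, cm_adj hij,
            TensorProduct.smul_tmul', neg_neg, zpow_one]
        · simp only [Algebra.TensorProduct.tmul_mul_tmul, one_mul, mul_one, K_F,
            cm_adj hij.symm, TensorProduct.smul_tmul', neg_neg, zpow_one])

/-- The counit: `E_i, F_i ↦ 0` and `L_j ↦ 1`. -/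
def counit (r : ℕ) : Uqgl r →ₐ[Cq] Cq :=
  lift (fun _ => 0) (fun _ => 0) (fun _ => 1) (fun _ => 1) (by
    intro x y h
    cases h <;> simp)

open MulOpposite in
theorem serre_op {A : Type} [Ring A] [Algebra Cq A] {e f : A} (c : Cq)
    (h : e * e * f - (q + q⁻¹) • (e * f * e) + f * e * e = 0) :
    op (c • e) * op (c • e) * op (c • f) - (q + q⁻¹) • (op (c • e) * op (c • f) * op (c • e))
      + op (c • f) * op (c • e) * op (c • e) = 0 := by
  have h' := congrArg (fun x => op ((c * c * c) • x)) h
  simp only [smul_zero, op_zero] at h'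
  rw [← h']
  simp only [← op_mul, ← op_smul, ← op_sub, ← op_add, smul_mul_assoc, mul_smul_comm, smul_smul,
    smul_add, smul_sub, mul_assoc, mul_left_comm _ c, mul_comm _ c]
  congr 1
  abel

open MulOpposite in
/-- The antipode, an anti-homomorphism: `S(E_i) = -E_i K_i`, `S(F_i) = -K_i⁻¹ F_i`,
`S(L_j) = L_j⁻¹`. -/
def antipode (r : ℕ) : Uqgl r →ₐ[Cq] (Uqgl r)ᵐᵒᵖ :=
  lift (fun i => op (-(E i * K i))) (fun i => op (-(Kinv i * F i)))
    (fun j => op (Linv j)) (fun j => op (L j)) (by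
      intro x y h
      cases h with
      | L_Linv j => exact congrArg op (L_mul_Linv j)
      | Linv_L j => exact congrArg op (Linv_mul_L j)
      | L_comm j k => exact congrArg op (Linv_comm k j).eq
      | L_E j i =>
        rw [← op_mul, ← op_mul, ← op_smul, neg_mul, mul_neg, smul_neg, ← mul_assoc, Linv_E,
          smul_mul_assoc, smul_smul, ← zpow_add₀ q_ne_zero, mul_assoc, mul_assoc,
          (Linv_K_comm j i).eq]
        simp
      | L_F j i =>
        rw [← op_mul, ← op_mul, ← op_smul, neg_mul, mul_neg, smul_neg, ← mul_assoc (Linv j),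
          (Linv_Kinv_comm j i).eq, mul_assoc (Kinv i) (Linv j), Linv_F, mul_smul_comm, smul_smul,
          ← zpow_add₀ q_ne_zero]
        simp [mul_assoc]
      | E_F i =>
        have h1 : E i * K i * (Kinv i * F i) = E i * F i := by
          rw [mul_assoc, ← mul_assoc (K i), K_mul_Kinv, one_mul]
        have h2 : Kinv i * F i * (E i * K i) = F i * E i := by
          rw [mul_assoc, ← mul_assoc (F i), ← mul_assoc, ← mul_assoc, Kinv_F, smul_mul_assoc,
            mul_assoc (F i), Kinv_E, mul_smul_comm, smul_smul, ← zpow_add₀ q_ne_zero,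
            smul_mul_assoc, mul_assoc, mul_assoc, Kinv_mul_K]
          simp
        have h3 : L i.succ * Linv i.castSucc = Kinv i := (L_Linv_comm _ _).eq
        have h4 : Linv i.succ * L i.castSucc = K i := (L_Linv_comm _ _).symm.eq
        simp only [← op_mul, ← op_smul, ← op_sub, neg_mul_neg, h1, h2, h3, h4]
        rw [← neg_sub (E i * F i), E_F, ← smul_neg, neg_sub]
      | E_F_ne i j hij =>
        have h := rel (.E_F_ne i j hij)
        simp only [← op_mul, neg_mul_neg]
        congr 1
        calc Kinv j * F j * (E i * K i) = Kinv j * (F j * E i) * K i := by simp only [mul_assoc]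
          _ = Kinv j * E i * (F j * K i) := by rw [← h]; simp only [mul_assoc]
          _ = E i * Kinv j * (K i * F j) := by
            rw [Kinv_E, K_F, cm_symm j i, smul_mul_assoc, mul_smul_comm]
          _ = E i * (K i * Kinv j) * F j := by rw [(K_Kinv_comm i j).eq]; simp only [mul_assoc]
          _ = E i * K i * (Kinv j * F j) := by simp only [mul_assoc]
      | E_far i j hij =>
        have h := rel (.E_far i j hij)
        have h1 : K i * E j = E j * K i := by simp [K_E, cm_far (.inl hij)]
        have h2 : K j * E i = E i * K j := by simp [K_E, cm_far (.inr hij)]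
        have hc : Commute (E i * K i) (E j * K j) :=
          (Commute.mul_right h h2.symm).mul_left (Commute.mul_right h1 (K_comm i j))
        simpa only [← op_mul, neg_mul_neg] using congrArg op hc.eq.symm
      | F_far i j hij =>
        have h := rel (.F_far i j hij)
        have h1 : Kinv i * F j = F j * Kinv i := by simp [Kinv_F, cm_far (.inl hij)]
        have h2 : Kinv j * F i = F i * Kinv j := by simp [Kinv_F, cm_far (.inr hij)]
        have hc : Commute (Kinv i * F i) (Kinv j * F j) :=
          (Commute.mul_right (Kinv_comm i j) h1).mul_left (Commute.mul_right h2.symm h)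
        simpa only [← op_mul, neg_mul_neg] using congrArg op hc.eq.symm
      | E_serre i j hij =>
        have h := serre_op (-1) (serre_twist (rel (.E_serre i j hij)) (K_comm i j).eq
          (by rw [K_E, cm_self]) (K_E i j) (by rw [K_E, cm_symm]))
        simpa only [neg_smul, one_smul] using h
      | F_serre i j hij =>
        have h := serre_op (-q ^ (2 : ℤ)) (serre_twist (rel (.F_serre i j hij)) (Kinv_comm i j).eq
          (by rw [Kinv_F, cm_self]) (Kinv_F i j) (by rw [Kinv_F, cm_symm]))
        simpa only [neg_smul, Kinv_F, cm_self] using h)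

end hopf

/-! ### Representations -/

/-- A representation over `ℂ(q)` of an algebra `A`. -/
structure QRep (A : Type) [Ring A] [Algebra Cq A] where
  /-- The underlying vector space. -/
  carrier : Type
  [addCommGroup : AddCommGroup carrier]
  [module : Module Cq carrier]
  /-- The action. -/
  ρ : A →ₐ[Cq] Module.End Cq carrier

attribute [instance] QRep.addCommGroup QRep.module

namespace QRep

variable {A B : Type} [Ring A] [Algebra Cq A] [Ring B] [Algebra Cq B]

instance : CoeSort (QRep A) Type := ⟨QRep.carrier⟩

/-- A linear map between representations is a homomorphism of representations. -/
def IsIntertwiner (M N : QRep A) (f : M →ₗ[Cq] N) : Prop :=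
  ∀ (a : A) (v : M), f (M.ρ a v) = N.ρ a (f v)

/-- Isomorphisms of representations. -/
structure Iso (M N : QRep A) where
  /-- The underlying linear isomorphism. -/
  toEquiv : M ≃ₗ[Cq] N
  isIntertwiner : IsIntertwiner M N toEquiv.toLinearMap

/-- Restriction of a representation along an algebra homomorphism. -/
@[reducible] def restrict (f : B →ₐ[Cq] A) (M : QRep A) : QRep B where
  carrier := M
  ρ := M.ρ.comp f

/-- The quotient of a representation by a subrepresentation. -/
@[reducible] def quotient (M : QRep A) (N : Submodule Cq M)
    (hN : ∀ (a : A), ∀ v ∈ N, M.ρ a v ∈ N) : QRep A where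
  carrier := M ⧸ N
  ρ :=
    { toFun := fun a => N.mapQ N (M.ρ a) (hN a)
      map_one' := by ext; simp
      map_mul' := fun a b => by ext; simp
      map_zero' := by ext; simp
      map_add' := fun a b => by ext; simp
      commutes' := fun c => by ext; simp }

end QRep

section reps

variable {r : ℕ}

/-- The trivial representation `ℂ_q`. -/
@[reducible] def triv (r : ℕ) : QRep (Uqgl r) where
  carrier := Cq
  ρ := (Algebra.lsmul Cq Cq Cq).comp (counit r)

/-- The tensor product of representations: `x` acts by `Δ(x)`. -/
@[reducible] def tensor (M N : QRep (Uqgl r)) : QRep (Uqgl r) where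
  carrier := M ⊗[Cq] N
  ρ := (Module.endTensorEndAlgHom (R := Cq) (S := Cq) (A := Cq) (M := M) (N := N)).comp
    ((Algebra.TensorProduct.map M.ρ N.ρ).comp (comul r))

/-- The dual representation: `(x f)(v) = f(S(x) v)`. -/
@[reducible] def dual (M : QRep (Uqgl r)) : QRep (Uqgl r) where
  carrier := Module.Dual Cq M
  ρ :=
    { toFun := fun a => Module.Dual.transpose (R := Cq) (M.ρ (antipode r a).unop)
      map_one' := by ext; simp [Module.Dual.transpose]
      map_mul' := fun a b => by ext; simp [Module.Dual.transpose]
      map_zero' := by ext; simp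
      map_add' := fun a b => by ext; simp
      commutes' := fun c => by ext; simp [Algebra.algebraMap_eq_smul_one, Module.Dual.transpose] }

theorem q_sub_ne_zero : q - q⁻¹ ≠ 0 := by
  intro h
  have h2 : q * q = 1 := by
    rw [sub_eq_zero] at h
    nth_rewrite 2 [h]
    exact mul_inv_cancel₀ q_ne_zero
  rw [q, ← RatFunc.algebraMap_X, ← map_mul, ← map_one (algebraMap (Polynomial ℂ) (RatFunc ℂ))] at h2
  have h3 := congrArg Polynomial.natDegree (RatFunc.algebraMap_injective ℂ h2)
  simp at h3

open Matrix in
/-- The matrices of the vector representation. -/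
def vecMatrix (r : ℕ) : Uqgl r →ₐ[Cq] Matrix (Fin (r + 1)) (Fin (r + 1)) Cq :=
  lift (fun i => single i.castSucc i.succ 1) (fun i => single i.succ i.castSucc 1)
    (fun j => diagonal fun k => if k = j then q else 1)
    (fun j => diagonal fun k => if k = j then q⁻¹ else 1) (by
      intro x y h
      have q0 := q_ne_zero
      cases h with
      | L_Linv j =>
        rw [diagonal_mul_diagonal, ← diagonal_one]
        congr 1; ext k
        by_cases hk : k = j <;> simp [hk, q0]
      | Linv_L j =>
        rw [diagonal_mul_diagonal, ← diagonal_one]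
        congr 1; ext k
        by_cases hk : k = j <;> simp [hk, q0]
      | L_comm j k => simp [mul_comm]
      | L_E j i =>
        ext a b
        simp only [Matrix.smul_apply, diagonal_mul, mul_diagonal, single_apply]
        by_cases h : i.castSucc = a ∧ i.succ = b
        · obtain ⟨rfl, rfl⟩ := h
          simp only [wt, eq_comm (a := j), and_self, if_true]
          split_ifs with h1 h2 <;> simp_all [Fin.ext_iff]
        · simp [h]
      | L_F j i =>
        ext a b
        simp only [Matrix.smul_apply, diagonal_mul, mul_diagonal, single_apply]
        by_cases h : i.succ = a ∧ i.castSucc = b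
        · obtain ⟨rfl, rfl⟩ := h
          simp only [wt, eq_comm (a := j), and_self, if_true]
          split_ifs with h1 h2 <;> simp_all [Fin.ext_iff]
        · simp [h]
      | E_F i =>
        have hq := q_sub_ne_zero
        have hne : i.castSucc ≠ i.succ := by simp [Fin.ext_iff]
        simp only [single_mul_single_same, mul_one, diagonal_mul_diagonal]
        rw [← diagonal_single, ← diagonal_single, diagonal_sub, diagonal_sub, ← diagonal_smul]
        congr 1; ext k
        by_cases h1 : k = i.castSucc
        · subst h1
          simp [hne, hq]
        · by_cases h2 : k = i.succ
          · subst h2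
            simp only [Pi.single_apply, hne.symm, if_true, if_false, Pi.smul_apply, smul_eq_mul,
              one_mul]
            rw [← neg_sub q, mul_neg, inv_mul_cancel₀ hq, zero_sub]
          · simp [h1, h2]
      | E_F_ne i j hij =>
        have h1 : i.succ ≠ j.succ := by simpa using hij
        have h2 : i.castSucc ≠ j.castSucc := by simpa using hij
        simp [single_mul_single_of_ne, h1, h2.symm]
      | E_far i j hij =>
        have h1 : i.succ ≠ j.castSucc := by simp [Fin.ext_iff]; omega
        have h2 : j.succ ≠ i.castSucc := by simp [Fin.ext_iff]; omega
        simp [single_mul_single_of_ne, h1, h2]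
      | F_far i j hij =>
        have h1 : i.castSucc ≠ j.succ := by simp [Fin.ext_iff]; omega
        have h2 : j.castSucc ≠ i.succ := by simp [Fin.ext_iff]; omega
        simp [single_mul_single_of_ne, h1, h2]
      | E_serre i j hij =>
        have h0 : i.succ ≠ i.castSucc := by simp [Fin.ext_iff]
        rcases hij with hij | hij
        · have h1 : j.succ ≠ i.castSucc := by simp [Fin.ext_iff]; omega
          simp [single_mul_single_of_ne, h0, h1, mul_assoc]
        · have h1 : i.succ ≠ j.castSucc := by simp [Fin.ext_iff]; omega
          simp [single_mul_single_of_ne, h0, h1, mul_assoc]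
      | F_serre i j hij =>
        have h0 : i.castSucc ≠ i.succ := by simp [Fin.ext_iff]
        rcases hij with hij | hij
        · have h1 : i.castSucc ≠ j.succ := by simp [Fin.ext_iff]; omega
          simp [single_mul_single_of_ne, h0, h1, mul_assoc]
        · have h1 : j.castSucc ≠ i.succ := by simp [Fin.ext_iff]; omega
          simp [single_mul_single_of_ne, h0, h1, mul_assoc])

/-- The vector representation `V = ℂ_q^{r+1}`: `E_i x_{i+1} = x_i`, `F_i x_i = x_{i+1}`,
`L_j x_j = q x_j`, and the generators act on the other basis vectors by `0` (for `E_i`, `F_i`)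
or `1` (for `L_j`). -/
@[reducible] def vec (r : ℕ) : QRep (Uqgl r) where
  carrier := Fin (r + 1) → Cq
  ρ := (Matrix.toLinAlgEquiv' : _ ≃ₐ[Cq] _).toAlgHom.comp (vecMatrix r)

/-- The basis vector `x_j` of the vector representation. -/
def x (j : Fin (r + 1)) : vec r := Pi.single j 1

/-- The tensor powers `V^{⊗ l} = V ⊗ (V ⊗ ( ⋯ ⊗ ℂ_q))`. -/
def tensorPow (r : ℕ) : ℕ → QRep (Uqgl r)
  | 0 => triv r
  | l + 1 => tensor (vec r) (tensorPow r l)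

/-- The subspace `I ⊆ V ⊗ V` of quantum symmetric tensors. -/
def quantumSym (r : ℕ) : Submodule Cq (vec r ⊗[Cq] vec r) :=
  Submodule.span Cq ({t | ∃ i, t = x i ⊗ₜ x i} ∪
    {t | ∃ i j, i < j ∧ t = x i ⊗ₜ x j + q⁻¹ • (x j ⊗ₜ x i)})

/-- The identification `V ⊗ V^{⊗ l} = V^{⊗ (l + 1)}`. -/
def tensorCons (r l : ℕ) : vec r ⊗[Cq] tensorPow r l ≃ₗ[Cq] tensorPow r (l + 1) :=
  LinearEquiv.refl Cq (tensor (vec r) (tensorPow r l))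

/-- The identification `(V ⊗ V) ⊗ V^{⊗ l} = V^{⊗ (l + 2)}`. -/
def tensorCons₂ (r l : ℕ) :
    (vec r ⊗[Cq] vec r) ⊗[Cq] tensorPow r l ≃ₗ[Cq] tensorPow r (l + 2) :=
  TensorProduct.assoc Cq (vec r) (vec r) (tensorPow r l) ≪≫ₗ
    (tensorCons r l).lTensor (vec r) ≪≫ₗ tensorCons r (l + 1)

/-- The subspace of `V^{⊗ l}` spanned by the `V^{⊗ s} ⊗ I ⊗ V^{⊗ (l - s - 2)}`, `0 ≤ s ≤ l - 2`:
it is the sum of `I ⊗ V^{⊗ (l - 2)}` (the term `s = 0`) and of `V ⊗ R`, with `R ⊆ V^{⊗ (l - 1)}`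
the corresponding subspace for `l - 1` (the terms `s ≥ 1`). -/
def wedgeRel (r : ℕ) : (l : ℕ) → Submodule Cq (tensorPow r l)
  | 0 => ⊥
  | 1 => ⊥
  | l + 2 =>
    (LinearMap.range ((quantumSym r).subtype.rTensor (tensorPow r l))).map
      (tensorCons₂ r l).toLinearMap ⊔
    (LinearMap.range ((wedgeRel r (l + 1)).subtype.lTensor (vec r))).map
      (tensorCons r (l + 1)).toLinearMap

/-! ### The subspaces above are subrepresentations -/

theorem E_x (i : Fin r) (k : Fin (r + 1)) :
    (vec r).ρ (E i) (x k) = if k = i.succ then x i.castSucc else 0 := by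
  ext a
  by_cases h : k = i.succ <;>
    simp [vecMatrix, lift_gen, genMap, x, Pi.single_apply, Matrix.single_apply, h, eq_comm]
  rfl

theorem F_x (i : Fin r) (k : Fin (r + 1)) :
    (vec r).ρ (F i) (x k) = if k = i.castSucc then x i.succ else 0 := by
  ext a
  by_cases h : k = i.castSucc <;>
    simp [vecMatrix, lift_gen, genMap, x, Pi.single_apply, Matrix.single_apply, h, eq_comm]
  rfl

theorem L_x (j k : Fin (r + 1)) :
    (vec r).ρ (L j) (x k) = (if k = j then q else 1) • x k := by
  ext a
  by_cases h : a = k <;> simp [vecMatrix, lift_gen, genMap, x, h]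

theorem Linv_x (j k : Fin (r + 1)) :
    (vec r).ρ (Linv j) (x k) = (if k = j then q⁻¹ else 1) • x k := by
  ext a
  by_cases h : a = k <;> simp [vecMatrix, lift_gen, genMap, x, h]

theorem K_x (i : Fin r) (k : Fin (r + 1)) : (vec r).ρ (K i) (x k) =
    ((if k = i.succ then q⁻¹ else 1) * (if k = i.castSucc then q else 1)) • x k := by
  rw [K, map_mul, Module.End.mul_apply, Linv_x, map_smul, L_x, smul_smul]

theorem Kinv_x (i : Fin r) (k : Fin (r + 1)) : (vec r).ρ (Kinv i) (x k) =
    ((if k = i.succ then q else 1) * (if k = i.castSucc then q⁻¹ else 1)) • x k := by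
  rw [Kinv, map_mul, Module.End.mul_apply, L_x, map_smul, Linv_x, smul_smul]

section tensor

variable (M N : QRep (Uqgl r)) (m : M) (n : N)

theorem tensor_E (i : Fin r) : (tensor M N).ρ (E i) (m ⊗ₜ n) =
    M.ρ (E i) m ⊗ₜ N.ρ (Kinv i) n + m ⊗ₜ N.ρ (E i) n := by
  simp only [comul, AlgHom.comp_apply, lift_gen, genMap, map_add, map_one,
    Algebra.TensorProduct.map_tmul]
  rfl

theorem tensor_F (i : Fin r) : (tensor M N).ρ (F i) (m ⊗ₜ n) =
    M.ρ (F i) m ⊗ₜ n + M.ρ (K i) m ⊗ₜ N.ρ (F i) n := by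
  simp only [comul, AlgHom.comp_apply, lift_gen, genMap, map_add, map_one,
    Algebra.TensorProduct.map_tmul]
  rfl

theorem tensor_L (j : Fin (r + 1)) : (tensor M N).ρ (L j) (m ⊗ₜ n) =
    M.ρ (L j) m ⊗ₜ N.ρ (L j) n := by
  simp only [comul, AlgHom.comp_apply, lift_gen, genMap, map_add, map_one,
    Algebra.TensorProduct.map_tmul]
  rfl

theorem tensor_Linv (j : Fin (r + 1)) : (tensor M N).ρ (Linv j) (m ⊗ₜ n) =
    M.ρ (Linv j) m ⊗ₜ N.ρ (Linv j) n := by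
  simp only [comul, AlgHom.comp_apply, lift_gen, genMap, map_add, map_one,
    Algebra.TensorProduct.map_tmul]
  rfl

theorem tensor_K (i : Fin r) : (tensor M N).ρ (K i) (m ⊗ₜ n) =
    M.ρ (K i) m ⊗ₜ N.ρ (K i) n := by
  rw [K, map_mul, Module.End.mul_apply, tensor_Linv, tensor_L, map_mul, map_mul,
    Module.End.mul_apply, Module.End.mul_apply]

theorem tensor_Kinv (i : Fin r) : (tensor M N).ρ (Kinv i) (m ⊗ₜ n) =
    M.ρ (Kinv i) m ⊗ₜ N.ρ (Kinv i) n := by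
  rw [Kinv, map_mul, Module.End.mul_apply, tensor_L, tensor_Linv, map_mul, map_mul,
    Module.End.mul_apply, Module.End.mul_apply]

end tensor

/-- A subspace stable under the generators is a subrepresentation. -/
theorem stable_of_gen (M : QRep (Uqgl r)) (N : Submodule Cq M)
    (h : ∀ g, ∀ v ∈ N, M.ρ (gen g) v ∈ N) (a : Uqgl r) : ∀ v ∈ N, M.ρ a v ∈ N := by
  obtain ⟨b, rfl⟩ : ∃ b, mk r b = a := RingQuot.mkAlgHom_surjective Cq _ a
  induction b using FreeAlgebra.induction with
  | grade0 c =>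
    intro v hv
    rw [AlgHom.commutes, AlgHom.commutes, Module.algebraMap_end_apply]
    exact N.smul_mem c hv
  | grade1 g => exact h g
  | mul b c hb hc =>
    intro v hv
    rw [map_mul, map_mul]
    exact hb _ (hc _ hv)
  | add b c hb hc =>
    intro v hv
    rw [map_add, map_add]
    exact N.add_mem (hb _ hv) (hc _ hv)

theorem sym_mem (i : Fin (r + 1)) : x i ⊗ₜ x i ∈ quantumSym r :=
  Submodule.subset_span (.inl ⟨i, rfl⟩)

theorem sym_mem' {i j : Fin (r + 1)} (h : i < j) :
    x i ⊗ₜ x j + q⁻¹ • (x j ⊗ₜ x i) ∈ quantumSym r :=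
  Submodule.subset_span (.inr ⟨i, j, h, rfl⟩)

theorem quantumSym_stable (a : Uqgl r) :
    ∀ v ∈ quantumSym r, (tensor (vec r) (vec r)).ρ a v ∈ quantumSym r := by
  refine stable_of_gen (tensor (vec r) (vec r)) (quantumSym r) (fun g v hv => ?_) a
  have q0 := q_ne_zero
  induction hv using Submodule.span_induction with
  | zero => rw [map_zero]; exact zero_mem _
  | add u v _ _ hu hv => rw [map_add]; exact add_mem hu hv
  | smul c v _ hv => rw [map_smul]; exact Submodule.smul_mem _ _ hv
  | mem v hv =>
    cases g with
    | L j =>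
      rcases hv with ⟨a, rfl⟩ | ⟨a, b, hab, rfl⟩
      · rw [tensor_L, L_x, TensorProduct.smul_tmul_smul]
        exact Submodule.smul_mem _ _ (sym_mem a)
      · rw [map_add, map_smul, tensor_L, tensor_L, L_x, L_x, TensorProduct.smul_tmul_smul,
          TensorProduct.smul_tmul_smul, mul_comm (ite (b = j) q 1), smul_comm, ← smul_add]
        exact Submodule.smul_mem _ _ (sym_mem' hab)
    | Linv j =>
      rcases hv with ⟨a, rfl⟩ | ⟨a, b, hab, rfl⟩
      · rw [tensor_Linv, Linv_x, TensorProduct.smul_tmul_smul]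
        exact Submodule.smul_mem _ _ (sym_mem a)
      · rw [map_add, map_smul, tensor_Linv, tensor_Linv, Linv_x, Linv_x,
          TensorProduct.smul_tmul_smul, TensorProduct.smul_tmul_smul,
          mul_comm (ite (b = j) q⁻¹ 1), smul_comm, ← smul_add]
        exact Submodule.smul_mem _ _ (sym_mem' hab)
    | E i =>
      have hne : i.castSucc < i.succ := Fin.castSucc_lt_succ
      rcases hv with ⟨a, rfl⟩ | ⟨a, b, hab, rfl⟩
      · rw [tensor_E, E_x, Kinv_x]
        by_cases ha : a = i.succ
        · subst ha
          have := Submodule.smul_mem _ q (sym_mem' hne)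
          simpa [hne.ne', q0] using this
        · simp [ha]
      · rw [map_add, map_smul, tensor_E, tensor_E, E_x, E_x, Kinv_x, Kinv_x]
        by_cases ha : a = i.succ
        · subst ha
          have h1 : b ≠ i.succ := hab.ne'
          have h2 : b ≠ i.castSucc := (hne.trans hab).ne'
          simpa [h1, h2] using sym_mem' (hne.trans hab)
        · by_cases hb : b = i.succ
          · subst hb
            by_cases hc : a = i.castSucc
            · subst hc
              have := Submodule.smul_mem _ (1 + q⁻¹ * q⁻¹) (sym_mem i.castSucc)
              simpa [hne.ne, add_smul, mul_smul] using this
            · have hlt : a < i.castSucc := by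
                rw [Fin.lt_def] at *
                simp only [Fin.ext_iff, Fin.val_succ, Fin.val_castSucc] at *
                omega
              simpa [ha, hc] using sym_mem' hlt
          · simp [ha, hb]
    | F i =>
      have hne : i.castSucc < i.succ := Fin.castSucc_lt_succ
      rcases hv with ⟨a, rfl⟩ | ⟨a, b, hab, rfl⟩
      · rw [tensor_F, F_x, K_x]
        by_cases ha : a = i.castSucc
        · subst ha
          have := Submodule.smul_mem _ q (sym_mem' hne)
          simpa [hne.ne, q0, add_comm, TensorProduct.smul_tmul'] using this
        · simp [ha]
      · rw [map_add, map_smul, tensor_F, tensor_F, F_x, F_x, K_x, K_x]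
        by_cases ha : a = i.castSucc
        · subst ha
          have h1 : b ≠ i.castSucc := hab.ne'
          by_cases hb : b = i.succ
          · subst hb
            have := Submodule.smul_mem _ (1 + q⁻¹ * q⁻¹) (sym_mem i.succ)
            simpa [hne.ne', add_smul, mul_smul, ← TensorProduct.smul_tmul'] using this
          · have hlt : i.succ < b := by
              rw [Fin.lt_def] at *
              simp only [Fin.ext_iff, Fin.val_succ, Fin.val_castSucc] at *
              omega
            simpa [h1, hb] using sym_mem' hlt
        · by_cases hb : b = i.castSucc
          · subst hb
            have h1 : a ≠ i.succ := (hab.trans hne).ne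
            simpa [ha, h1] using sym_mem' (hab.trans hne)
          · simp [ha, hb]

theorem ρ_tensorCons (l : ℕ) (a : Uqgl r) (z : vec r ⊗[Cq] tensorPow r l) :
    (tensorPow r (l + 1)).ρ a (tensorCons r l z) =
      tensorCons r l ((tensor (vec r) (tensorPow r l)).ρ a z) := rfl

theorem tensorCons₂_tmul (l : ℕ) (v w : vec r) (t : tensorPow r l) :
    tensorCons₂ r l ((v ⊗ₜ w) ⊗ₜ t) = tensorCons r (l + 1) (v ⊗ₜ tensorCons r l (w ⊗ₜ t)) := rfl

theorem tensorCons₂_intertwines (l : ℕ) (g : Gen r)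
    (z : (vec r ⊗[Cq] vec r) ⊗[Cq] tensorPow r l) :
    (tensorPow r (l + 2)).ρ (gen g) (tensorCons₂ r l z) =
      tensorCons₂ r l ((tensor (tensor (vec r) (vec r)) (tensorPow r l)).ρ (gen g) z) := by
  suffices h : (tensorPow r (l + 2)).ρ (gen g) ∘ₗ (tensorCons₂ r l).toLinearMap =
      (tensorCons₂ r l).toLinearMap ∘ₗ
        (tensor (tensor (vec r) (vec r)) (tensorPow r l)).ρ (gen g) from
    LinearMap.congr_fun h z
  apply TensorProduct.ext_threefold
  intro v w t
  change (tensorPow r (l + 2)).ρ (gen g)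
      (tensorCons r (l + 1) (v ⊗ₜ tensorCons r l (w ⊗ₜ t))) =
    tensorCons₂ r l ((tensor (tensor (vec r) (vec r)) (tensorPow r l)).ρ (gen g) ((v ⊗ₜ w) ⊗ₜ t))
  rw [ρ_tensorCons]
  cases g with
  | E i =>
    rw [tensor_E, tensor_E, ρ_tensorCons, ρ_tensorCons, tensor_E, tensor_Kinv, tensor_E]
    simp only [TensorProduct.add_tmul, TensorProduct.tmul_add, map_add, tensorCons₂_tmul]
    abel
  | F i =>
    rw [tensor_F, tensor_F, ρ_tensorCons, tensor_F, tensor_K, tensor_F]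
    simp only [TensorProduct.add_tmul, TensorProduct.tmul_add, map_add, tensorCons₂_tmul]
    abel
  | L j => rw [tensor_L, tensor_L, ρ_tensorCons, tensor_L, tensor_L, tensorCons₂_tmul]
  | Linv j =>
    rw [tensor_Linv, tensor_Linv, ρ_tensorCons, tensor_Linv, tensor_Linv, tensorCons₂_tmul]

theorem tensor_gen_mem (M N : QRep (Uqgl r)) (P : Submodule Cq M) (Q : Submodule Cq N)
    (S : Submodule Cq (M ⊗[Cq] N)) (hP : ∀ a : Uqgl r, ∀ m ∈ P, M.ρ a m ∈ P)
    (hQ : ∀ a : Uqgl r, ∀ n ∈ Q, N.ρ a n ∈ Q) (hS : ∀ m ∈ P, ∀ n ∈ Q, m ⊗ₜ n ∈ S)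
    (g : Gen r) (m : M) (hm : m ∈ P) (n : N) (hn : n ∈ Q) :
    (tensor M N).ρ (gen g) (m ⊗ₜ n) ∈ S := by
  cases g with
  | E i =>
    rw [tensor_E]
    exact add_mem (hS _ (hP _ _ hm) _ (hQ _ _ hn)) (hS _ hm _ (hQ _ _ hn))
  | F i =>
    rw [tensor_F]
    exact add_mem (hS _ (hP _ _ hm) _ hn) (hS _ (hP _ _ hm) _ (hQ _ _ hn))
  | L j => rw [tensor_L]; exact hS _ (hP _ _ hm) _ (hQ _ _ hn)
  | Linv j => rw [tensor_Linv]; exact hS _ (hP _ _ hm) _ (hQ _ _ hn)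

theorem tensorCons₂_mem (l : ℕ) (s : vec r ⊗[Cq] vec r) (hs : s ∈ quantumSym r)
    (t : tensorPow r l) : tensorCons₂ r l (s ⊗ₜ t) ∈ wedgeRel r (l + 2) := by
  rw [wedgeRel]
  exact Submodule.mem_sup_left ⟨s ⊗ₜ t, ⟨(⟨s, hs⟩ : quantumSym r) ⊗ₜ t, rfl⟩, rfl⟩

theorem tensorCons_mem (l : ℕ) (v : vec r) (t : tensorPow r l) (ht : t ∈ wedgeRel r l) :
    tensorCons r l (v ⊗ₜ t) ∈ wedgeRel r (l + 1) := by
  cases l with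
  | zero =>
    rw [wedgeRel, Submodule.mem_bot] at ht
    rw [ht, TensorProduct.tmul_zero, map_zero]
    exact zero_mem _
  | succ l =>
    rw [wedgeRel]
    exact Submodule.mem_sup_right ⟨v ⊗ₜ t, ⟨v ⊗ₜ (⟨t, ht⟩ : wedgeRel r (l + 1)), rfl⟩, rfl⟩

theorem wedgeRel_stable : (l : ℕ) → (a : Uqgl r) →
    ∀ v ∈ wedgeRel r l, (tensorPow r l).ρ a v ∈ wedgeRel r l
  | 0, a => by intro v hv; rw [wedgeRel, Submodule.mem_bot] at *; rw [hv, map_zero]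
  | 1, a => by intro v hv; rw [wedgeRel, Submodule.mem_bot] at *; rw [hv, map_zero]
  | l + 2, a => by
    have ih := wedgeRel_stable (l + 1)
    refine stable_of_gen (tensorPow r (l + 2)) _ (fun g => ?_) a
    suffices h : wedgeRel r (l + 2) ≤
      (wedgeRel r (l + 2)).comap ((tensorPow r (l + 2)).ρ (gen g)) from h
    conv_lhs => rw [wedgeRel]
    refine sup_le ?_ ?_
    · rintro _ ⟨_, ⟨z, rfl⟩, rfl⟩
      induction z using TensorProduct.induction_on with
      | zero => simp only [map_zero, zero_mem]
      | add u w hu hw => simp only [map_add]; exact add_mem hu hw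
      | tmul s t =>
        rw [Submodule.mem_comap, LinearMap.rTensor_tmul, LinearEquiv.coe_coe,
          tensorCons₂_intertwines]
        exact tensor_gen_mem (tensor (vec r) (vec r)) (tensorPow r l) (quantumSym r) ⊤
          ((wedgeRel r (l + 2)).comap (tensorCons₂ r l).toLinearMap) quantumSym_stable
          (fun _ _ _ => trivial) (fun s hs t _ => tensorCons₂_mem l s hs t) g s s.2 t trivial
    · rintro _ ⟨_, ⟨z, rfl⟩, rfl⟩
      induction z using TensorProduct.induction_on with
      | zero => simp only [map_zero, zero_mem]
      | add u w hu hw => simp only [map_add]; exact add_mem hu hw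
      | tmul v t =>
        rw [Submodule.mem_comap, LinearMap.lTensor_tmul, LinearEquiv.coe_coe, ρ_tensorCons]
        exact tensor_gen_mem (vec r) (tensorPow r (l + 1)) ⊤ (wedgeRel r (l + 1))
          ((wedgeRel r (l + 2)).comap (tensorCons r (l + 1)).toLinearMap)
          (fun _ _ _ => trivial) ih (fun v _ t ht => tensorCons_mem (l + 1) v t ht) g v trivial t t.2

/-! ### Quantum exterior powers -/

/-- The quantum exterior power `⋀_q^l(V)`. -/
@[reducible] def wedge (r l : ℕ) : QRep (Uqgl r) :=
  (tensorPow r l).quotient (wedgeRel r l) (wedgeRel_stable l)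

/-- The natural projection `V ⊗ ⋀_q^l(V) → ⋀_q^{l+1}(V)`, which sends `v ⊗ [t]` to `[v ⊗ t]`. -/
def wedgeProj (r l : ℕ) : tensor (vec r) (wedge r l) →ₗ[Cq] wedge r (l + 1) :=
  TensorProduct.lift (LinearMap.flip ((wedgeRel r l).liftQ
    ((TensorProduct.mk Cq (vec r) (tensorPow r l)).compr₂
      ((wedgeRel r (l + 1)).mkQ ∘ₗ (tensorCons r l).toLinearMap)).flip
    (fun t ht => by
      refine LinearMap.ext fun v => ?_
      exact (Submodule.Quotient.mk_eq_zero _).2 (tensorCons_mem l v t ht))))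

theorem wedgeProj_tmul (l : ℕ) (v : vec r) (t : tensorPow r l) :
    wedgeProj r l (v ⊗ₜ Submodule.Quotient.mk t) =
      Submodule.Quotient.mk (tensorCons r l (v ⊗ₜ t)) := rfl

/-- The duality pairing `V ⊗ V* → ℂ_q`, `x_k ⊗ f ↦ q^{2k - m - 1} f(x_k)` for `1 ≤ k ≤ m = r + 1`.
Below the index `k` starts at `0`, so that the exponent is `2k - r`. -/
def cap (r : ℕ) : tensor (vec r) (dual (vec r)) →ₗ[Cq] triv r :=
  TensorProduct.lift (∑ k : Fin (r + 1), q ^ (2 * (k : ℤ) - r) •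
    (LinearMap.proj k : vec r →ₗ[Cq] Cq).smulRight (Module.Dual.eval Cq (vec r) (x k)))

theorem cap_tmul (k : Fin (r + 1)) (f : Module.Dual Cq (vec r)) :
    cap r (x k ⊗ₜ f) = q ^ (2 * (k : ℤ) - r) * f (x k) := by
  simp [cap, x, Pi.single_apply]

end reps

/-! ### Restriction to `U_q(sl_m)` -/

/-- `U_q(sl_{r+1})`, the subalgebra of `U_q(gl_{r+1})` generated by the `E_i`, `F_i`, `K_i^{±1}`. -/
def Uqsl (r : ℕ) : Subalgebra Cq (Uqgl r) :=
  Algebra.adjoin Cq (Set.range E ∪ Set.range F ∪ Set.range K ∪ Set.range Kinv)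

/-- The restriction of a representation of `U_q(gl_{r+1})` to `U_q(sl_{r+1})`. -/
@[reducible] def res {r : ℕ} (M : QRep (Uqgl r)) : QRep (Uqsl r) := M.restrict (Uqsl r).val

end QuantumGl

end

noncomputable section

namespace QuantumGl

variable {r : ℕ}

/-! ### The quantum Fock space -/

/-! Everything is computed with the ordered monomials $x_S = x_{s_1}\cdots x_{s_l}$, $s_1 < \dots <
s_l$. The relations allow sorting: moving $x_i$ past a smaller $x_a$ costs a factor $-q$, and $x_i
x_i = 0$. Hence $x_i x_S$ is $0$ or a power of $-q$ times $x_{S\cup\{i\}}$ (`wedgeProj_wedgeMon`),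
and the monomials span (`wedge_induction`). The converse danger, that the relations kill too much,
is excluded by a model: creation operators on a space with basis $e_S$ satisfy the same relations
and send $x_S$ to $e_S$, so $x_S \ne 0$. Thus $\bigwedge_q^m(V)$ is a line. Every $L_j$ acts on it
by $q$, so $K_i^{\pm1}$ acts by $1$; $E_i$ and $F_i$ shift the weight and so act by $0$. Every
linear form on this line is therefore $U_q(\mathfrak{sl}_m)$-invariant. For the duality, $x_j$ times
the monomial omitting $x_k$ is $0$ if $j \ne k$ and a nonzero multiple of the top monomial if $j =
k$. In suitable coordinates $\varphi \circ p$ is thus a nonzero multiple of the dot product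
(`wedgeProj_dualMon`), and both adjoint maps are bijective. Their equivariance is formal: an
invariant pairing $M \otimes N \to \mathbb{C}_q$ curries to a homomorphism $M \to N^*$, and a linear
map $N \to N'$ carrying one invariant pairing to another that is nondegenerate in $N'$ is a
homomorphism (`isIntertwiner_of_pairing`). The second fact is applied with $N' = V^*$ and the
pairing `cap`, whose powers of $q$ make it invariant although $V$ stands to the left of $V^*$. -/

/-- The space with basis `e_S`, for `S` a set of indices of basis vectors of `V`. -/
abbrev Fock (r : ℕ) : Type := Finset (Fin (r + 1)) →₀ Cq

/-- The number of elements of `S` below `i`. -/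
def below (i : Fin (r + 1)) (S : Finset (Fin (r + 1))) : ℕ := (S.filter (· < i)).card

theorem below_insert_of_le {i j : Fin (r + 1)} (h : i ≤ j) (S : Finset (Fin (r + 1))) :
    below i (insert j S) = below i S := by
  rw [below, Finset.filter_insert, if_neg h.not_gt, below]

theorem below_insert_of_lt {i j : Fin (r + 1)} (h : j < i) {S : Finset (Fin (r + 1))}
    (hj : j ∉ S) : below i (insert j S) = below i S + 1 := by
  rw [below, Finset.filter_insert, if_pos h, Finset.card_insert_of_notMem (by simp [hj]), below]

theorem below_eq_zero {i : Fin (r + 1)} {S : Finset (Fin (r + 1))} (h : ∀ j ∈ S, i ≤ j) :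
    below i S = 0 := by
  rw [below, Finset.card_eq_zero, Finset.filter_eq_empty_iff]
  exact fun j hj => (h j hj).not_gt

/-- The creation operator `e_S ↦ (-q)^{#{j ∈ S, j < i}} e_{S ∪ {i}}` for `i ∉ S`, and `e_S ↦ 0` for
`i ∈ S`. -/
def creation (i : Fin (r + 1)) : Fock r →ₗ[Cq] Fock r :=
  Finsupp.linearCombination Cq fun S =>
    if i ∈ S then 0 else Finsupp.single (insert i S) ((-q) ^ below i S)

theorem creation_single (i : Fin (r + 1)) (S : Finset (Fin (r + 1))) :
    creation i (Finsupp.single S 1) =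
      if i ∈ S then 0 else Finsupp.single (insert i S) ((-q) ^ below i S) := by
  simp [creation]

theorem creation_creation_self (i : Fin (r + 1)) (w : Fock r) : creation i (creation i w) = 0 := by
  suffices h : creation i ∘ₗ creation i = 0 from LinearMap.congr_fun h w
  ext1 S
  ext1
  rw [LinearMap.comp_apply, LinearMap.comp_apply, Finsupp.lsingle_apply, creation_single]
  split_ifs
  · simp
  · simp [creation]

/-- If $i$ or $j$ lies in $S$, both terms vanish on $e_S$. Otherwise inserting $j$ does not change
the number of elements below $i$, while inserting $i$ adds one to the number below $j$. The second
order thus carries an extra $-q$, which $q^{-1}$ turns into $-1$. -/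
theorem creation_creation {i j : Fin (r + 1)} (h : i < j) (w : Fock r) :
    creation i (creation j w) + q⁻¹ • creation j (creation i w) = 0 := by
  suffices h : creation i ∘ₗ creation j + q⁻¹ • (creation j ∘ₗ creation i) = 0 from
    LinearMap.congr_fun h w
  have q0 := q_ne_zero
  ext1 S
  ext1
  by_cases hi : i ∈ S
  · by_cases hj : j ∈ S <;> simp [creation, hi, hj]
  · by_cases hj : j ∈ S
    · simp [creation, hi, hj]
    · simp only [creation, LinearMap.comp_apply, LinearMap.add_apply, LinearMap.smul_apply,
        Finsupp.lsingle_apply, Finsupp.linearCombination_single, hi, hj, if_false, one_smul,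
        Finset.mem_insert, h.ne, h.ne', or_self, below_insert_of_le h.le,
        below_insert_of_lt h hi, Finsupp.smul_single, smul_eq_mul, Finset.insert_comm j i,
        ← Finsupp.single_add, LinearMap.zero_apply]
      rw [Finsupp.single_eq_zero]
      field_simp
      ring

/-- The vector `v` acts on the Fock space by `x_i ↦ creation i`. -/
def fockAct (r : ℕ) : vec r →ₗ[Cq] Fock r →ₗ[Cq] Fock r :=
  Fintype.linearCombination Cq creation

theorem fockAct_x (i : Fin (r + 1)) : fockAct r (x i) = creation i := by
  simp [fockAct, x]

/-- The map from the tensor powers to the Fock space that sends `v_1 ⊗ ⋯ ⊗ v_l` to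
`v_1 ⋯ v_l e_∅`. -/
def toFock (r : ℕ) : (l : ℕ) → tensorPow r l →ₗ[Cq] Fock r
  | 0 => LinearMap.toSpanSingleton Cq (Fock r) (Finsupp.single ∅ 1)
  | l + 1 => TensorProduct.lift ((fockAct r).compl₂ (toFock r l)) ∘ₗ
      (tensorCons r l).symm.toLinearMap

theorem toFock_tensorCons (l : ℕ) (v : vec r) (t : tensorPow r l) :
    toFock r (l + 1) (tensorCons r l (v ⊗ₜ t)) = fockAct r v (toFock r l t) := by
  simp [toFock]

/-- A relation in the first two slots acts through the two creation identities; a relation further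
to the right is already sent to $0$, by induction, before the first vector acts. -/
theorem wedgeRel_le_ker_toFock : (l : ℕ) → wedgeRel r l ≤ LinearMap.ker (toFock r l)
  | 0 => by rw [wedgeRel]; exact bot_le
  | 1 => by rw [wedgeRel]; exact bot_le
  | l + 2 => by
    have ih := wedgeRel_le_ker_toFock (l + 1)
    rw [wedgeRel]
    refine sup_le ?_ ?_
    · rintro _ ⟨_, ⟨z, rfl⟩, rfl⟩
      induction z using TensorProduct.induction_on with
      | zero => simp only [map_zero, zero_mem]
      | add u w hu hw => simp only [map_add]; exact add_mem hu hw
      | tmul s t =>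
        obtain ⟨s, hs⟩ := s
        simp only [LinearMap.rTensor_tmul, Submodule.subtype_apply, LinearMap.mem_ker,
          LinearEquiv.coe_coe]
        induction hs using Submodule.span_induction with
        | zero => simp only [TensorProduct.zero_tmul, map_zero]
        | add u v _ _ hu hv => rw [TensorProduct.add_tmul, map_add, map_add, hu, hv, add_zero]
        | smul c v _ hv => rw [← TensorProduct.smul_tmul', map_smul, map_smul, hv, smul_zero]
        | mem v hv =>
          rcases hv with ⟨a, rfl⟩ | ⟨a, b, hab, rfl⟩
          · rw [tensorCons₂_tmul, toFock_tensorCons, toFock_tensorCons, fockAct_x,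
              creation_creation_self]
          · rw [TensorProduct.add_tmul, ← TensorProduct.smul_tmul', map_add, map_add, map_smul,
              map_smul, tensorCons₂_tmul, tensorCons₂_tmul, toFock_tensorCons, toFock_tensorCons,
              toFock_tensorCons, toFock_tensorCons, fockAct_x, fockAct_x, creation_creation hab]
    · rintro _ ⟨_, ⟨z, rfl⟩, rfl⟩
      induction z using TensorProduct.induction_on with
      | zero => simp only [map_zero, zero_mem]
      | add u w hu hw => simp only [map_add]; exact add_mem hu hw
      | tmul v t =>
        rw [LinearMap.lTensor_tmul, LinearMap.mem_ker, LinearEquiv.coe_coe, toFock_tensorCons,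
          Submodule.subtype_apply, LinearMap.mem_ker.1 (ih t.2), map_zero]

/-- The map from the quantum exterior powers to the Fock space. -/
def wedgeToFock (r l : ℕ) : wedge r l →ₗ[Cq] Fock r :=
  (wedgeRel r l).liftQ (toFock r l) (wedgeRel_le_ker_toFock l)

theorem wedgeToFock_wedgeProj (l : ℕ) (v : vec r) (w : wedge r l) :
    wedgeToFock r (l + 1) (wedgeProj r l (v ⊗ₜ w)) = fockAct r v (wedgeToFock r l w) := by
  obtain ⟨t, rfl⟩ := Submodule.Quotient.mk_surjective _ w
  exact toFock_tensorCons l v t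

/-! ### Monomials in the quantum exterior powers -/

theorem wedgeProj_surjective (l : ℕ) : Function.Surjective (wedgeProj r l) := by
  intro w
  obtain ⟨t, rfl⟩ := Submodule.Quotient.mk_surjective _ w
  obtain ⟨z, rfl⟩ := (tensorCons r l).surjective t
  induction z using TensorProduct.induction_on with
  | zero => exact ⟨0, by simp⟩
  | add u v hu hv =>
    obtain ⟨a, ha⟩ := hu
    obtain ⟨b, hb⟩ := hv
    exact ⟨a + b, by rw [map_add, ha, hb, map_add, Submodule.Quotient.mk_add]⟩
  | tmul v t => exact ⟨v ⊗ₜ Submodule.Quotient.mk t, wedgeProj_tmul l v t⟩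

theorem wedgeProj_self (l : ℕ) (i : Fin (r + 1)) (w : wedge r l) :
    wedgeProj r (l + 1) (x i ⊗ₜ wedgeProj r l (x i ⊗ₜ w)) = 0 := by
  obtain ⟨t, rfl⟩ := Submodule.Quotient.mk_surjective _ w
  exact (Submodule.Quotient.mk_eq_zero _).2 (tensorCons₂_mem l _ (sym_mem i) t)

/-- The quadratic relation solved for the product in the wrong order; this is the sorting rule. -/
theorem wedgeProj_swap (l : ℕ) {i j : Fin (r + 1)} (h : i < j) (w : wedge r l) :
    wedgeProj r (l + 1) (x j ⊗ₜ wedgeProj r l (x i ⊗ₜ w)) =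
      -q • wedgeProj r (l + 1) (x i ⊗ₜ wedgeProj r l (x j ⊗ₜ w)) := by
  have q0 := q_ne_zero
  obtain ⟨t, rfl⟩ := Submodule.Quotient.mk_surjective _ w
  have h1 := tensorCons₂_mem l _ (sym_mem' h) t
  rw [TensorProduct.add_tmul, ← TensorProduct.smul_tmul', map_add, map_smul, tensorCons₂_tmul,
    tensorCons₂_tmul] at h1
  have h2 : wedgeProj r (l + 1) (x i ⊗ₜ wedgeProj r l (x j ⊗ₜ Submodule.Quotient.mk t)) +
      q⁻¹ • wedgeProj r (l + 1) (x j ⊗ₜ wedgeProj r l (x i ⊗ₜ Submodule.Quotient.mk t)) = 0 :=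
    (Submodule.Quotient.mk_eq_zero _).2 h1
  rw [eq_neg_of_add_eq_zero_left h2, smul_neg, neg_smul, neg_neg, smul_smul, mul_inv_cancel₀ q0,
    one_smul]

/-- The product `x_{s_1} ⋯ x_{s_l}` in `⋀_q^l(V)` if `S` is the set with elements
`s_1 < ⋯ < s_l`. -/
def wedgeMon : (l : ℕ) → Finset (Fin (r + 1)) → wedge r l
  -- The value is meaningful for `S.card = l`. For larger `S` the product stops after the `l`
  -- smallest elements; for smaller `S` it is `0`.
  | 0, _ => (wedgeRel r 0).mkQ (1 : Cq)
  | l + 1, S => if h : S.Nonempty then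
      wedgeProj r l (x (S.min' h) ⊗ₜ wedgeMon l (S.erase (S.min' h))) else 0

theorem wedgeMon_insert (l : ℕ) (i : Fin (r + 1)) (S : Finset (Fin (r + 1)))
    (h : ∀ j ∈ S, i < j) :
    wedgeMon (l + 1) (insert i S) = wedgeProj r l (x i ⊗ₜ wedgeMon l S) := by
  have hi : (insert i S).min' (Finset.insert_nonempty i S) = i :=
    le_antisymm (Finset.min'_le _ _ (Finset.mem_insert_self i S))
      (Finset.le_min' _ _ _ (by simpa using fun j hj => (h j hj).le))
  rw [wedgeMon, dif_pos (Finset.insert_nonempty i S), hi,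
    Finset.erase_insert fun hS => (h i hS).false]

/-- Sets of cardinality `l + 1` are obtained by adding a new minimum to a set of cardinality
`l`. -/
theorem exists_insert_min {l : ℕ} {S : Finset (Fin (r + 1))} (hS : S.card = l + 1) :
    ∃ a T, T.card = l ∧ (∀ j ∈ T, a < j) ∧ S = insert a T := by
  have hne : S.Nonempty := Finset.card_pos.1 (by omega)
  refine ⟨S.min' hne, S.erase (S.min' hne), ?_, fun j => S.min'_lt_of_mem_erase_min' hne,
    (Finset.insert_erase (S.min'_mem hne)).symm⟩
  rw [Finset.card_erase_of_mem (S.min'_mem hne), hS, Nat.add_sub_cancel]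

/-- Sorting by induction on the minimum $a$ of $S$: if $i < a$ the product is already ordered, if $i
= a$ it contains a square, and if $i > a$ one swap costs $-q$ and leaves $x_i$ to be sorted into $S
\setminus \{a\}$. The formula is that of the creation operators. -/
theorem wedgeProj_wedgeMon (l : ℕ) (i : Fin (r + 1)) (S : Finset (Fin (r + 1)))
    (hS : S.card = l) : wedgeProj r l (x i ⊗ₜ wedgeMon l S) =
      if i ∈ S then 0 else (-q) ^ below i S • wedgeMon (l + 1) (insert i S) := by
  induction l generalizing i S with
  | zero =>
    obtain rfl := Finset.card_eq_zero.1 hS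
    rw [wedgeMon_insert 0 i ∅ (by simp), below_eq_zero (by simp)]
    simp
  | succ l ih =>
    obtain ⟨a, T, hT, ha, rfl⟩ := exists_insert_min hS
    have haT : a ∉ T := fun h => (ha a h).false
    rcases lt_trichotomy i a with hi | rfl | hi
    · have h : ∀ j ∈ insert a T, i < j := by simpa [hi] using fun j hj => hi.trans (ha j hj)
      rw [if_neg fun h1 => (h i h1).false, below_eq_zero fun j hj => (h j hj).le, pow_zero,
        one_smul, wedgeMon_insert (l + 1) i _ h]
    · rw [wedgeMon_insert l i T ha, wedgeProj_self, if_pos (Finset.mem_insert_self i T)]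
    · rw [wedgeMon_insert l a T ha, wedgeProj_swap l hi, ih i T hT]
      by_cases hiT : i ∈ T
      · simp [hiT]
      · have h : ∀ j ∈ insert i T, a < j := by simpa [hi] using ha
        rw [if_neg hiT, if_neg (by simp [hiT, hi.ne']), below_insert_of_lt hi haT,
          Finset.insert_comm, wedgeMon_insert (l + 1) a _ h, TensorProduct.tmul_smul, map_smul,
          smul_smul, pow_succ']

/-- Each factor of an ordered monomial is inserted below all those already present, so every
exponent of $-q$ is $0$. -/
theorem wedgeToFock_wedgeMon (l : ℕ) (S : Finset (Fin (r + 1))) (hS : S.card = l) :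
    wedgeToFock r l (wedgeMon l S) = Finsupp.single S 1 := by
  induction l generalizing S with
  | zero =>
    obtain rfl := Finset.card_eq_zero.1 hS
    change toFock r 0 (1 : Cq) = _
    exact one_smul _ _
  | succ l ih =>
    obtain ⟨a, T, hT, ha, rfl⟩ := exists_insert_min hS
    rw [wedgeMon_insert l a T ha, wedgeToFock_wedgeProj, ih T hT, fockAct_x, creation_single,
      if_neg fun h => (ha a h).false, below_eq_zero fun j hj => (ha j hj).le, pow_zero]

/-- Needed only in top degree: in degree $m-1$ the nondegeneracy of the pairing takes the place of
linear independence. -/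
theorem wedgeMon_ne_zero {l : ℕ} {S : Finset (Fin (r + 1))} (hS : S.card = l) :
    wedgeMon l S ≠ 0 := by
  intro h
  have h1 := wedgeToFock_wedgeMon l S hS
  rw [h, map_zero] at h1
  simpa using h1.symm

theorem span_x : Submodule.span Cq (Set.range (x (r := r))) = ⊤ := by
  rw [← (Pi.basisFun Cq (Fin (r + 1))).span_eq]
  congr 2
  ext i
  simp [x]

/-- The monomials span the quantum exterior powers. -/
theorem wedge_induction {l : ℕ} {P : Submodule Cq (wedge r l)}
    (h : ∀ S : Finset (Fin (r + 1)), S.card = l → wedgeMon l S ∈ P) (w : wedge r l) : w ∈ P := by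
  induction l with
  | zero =>
    obtain ⟨t, rfl⟩ := Submodule.Quotient.mk_surjective _ w
    have h1 (c : Cq) : (wedgeRel r 0).mkQ c ∈ P := by
      have h2 : (wedgeRel r 0).mkQ c = c • wedgeMon 0 ∅ :=
        (congrArg (wedgeRel r 0).mkQ (mul_one c).symm).trans
          (map_smul (wedgeRel r 0).mkQ c (1 : Cq))
      exact h2 ▸ P.smul_mem c (h ∅ rfl)
    exact h1 t
  | succ l ih =>
    obtain ⟨z, rfl⟩ := wedgeProj_surjective l w
    induction z using TensorProduct.induction_on with
    | zero => rw [map_zero]; exact P.zero_mem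
    | add u v hu hv => rw [map_add]; exact P.add_mem hu hv
    | tmul v w =>
      have hv : v ∈ Submodule.span Cq (Set.range (x (r := r))) := span_x ▸ Submodule.mem_top
      induction hv using Submodule.span_induction with
      | zero => rw [TensorProduct.zero_tmul, map_zero]; exact P.zero_mem
      | add u v _ _ hu hv => rw [TensorProduct.add_tmul, map_add]; exact P.add_mem hu hv
      | smul c v _ hv => rw [← TensorProduct.smul_tmul', map_smul]; exact P.smul_mem c hv
      | mem v hv =>
        obtain ⟨i, rfl⟩ := hv
        -- For fixed $i$, the induction hypothesis is applied to the subspace of those $w$ with $x_i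
        -- w \in P$.
        refine ih (P := P.comap (wedgeProj r l ∘ₗ TensorProduct.mk Cq _ _ (x i))) (fun S hS => ?_) w
        change wedgeProj r l (x i ⊗ₜ wedgeMon l S) ∈ P
        rw [wedgeProj_wedgeMon l i S hS]
        split_ifs with hi
        · exact P.zero_mem
        · exact P.smul_mem _ (h _ (by rw [Finset.card_insert_of_notMem hi, hS]))

/-! ### Homomorphisms of representations of `U_q(sl_m)` -/

theorem triv_E (i : Fin r) (c : triv r) : (triv r).ρ (E i) c = 0 := by
  simp [counit, lift_gen, genMap]

theorem triv_F (i : Fin r) (c : triv r) : (triv r).ρ (F i) c = 0 := by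
  simp [counit, lift_gen, genMap]

theorem triv_K (i : Fin r) (c : triv r) : (triv r).ρ (K i) c = c := by
  simp [K, counit, lift_gen, genMap]

theorem triv_Kinv (i : Fin r) (c : triv r) : (triv r).ρ (Kinv i) c = c := by
  simp [Kinv, counit, lift_gen, genMap]

theorem E_mem (i : Fin r) : E i ∈ Uqsl r :=
  Algebra.subset_adjoin (.inl (.inl (.inl ⟨i, rfl⟩)))

theorem F_mem (i : Fin r) : F i ∈ Uqsl r :=
  Algebra.subset_adjoin (.inl (.inl (.inr ⟨i, rfl⟩)))

theorem K_mem (i : Fin r) : K i ∈ Uqsl r :=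
  Algebra.subset_adjoin (.inl (.inr ⟨i, rfl⟩))

theorem Kinv_mem (i : Fin r) : Kinv i ∈ Uqsl r :=
  Algebra.subset_adjoin (.inr ⟨i, rfl⟩)

/-- A linear map that commutes with the generators of `U_q(sl_m)` is a homomorphism. -/
theorem isIntertwiner_res {M N : QRep (Uqgl r)} (f : M →ₗ[Cq] N)
    (hE : ∀ i v, f (M.ρ (E i) v) = N.ρ (E i) (f v))
    (hF : ∀ i v, f (M.ρ (F i) v) = N.ρ (F i) (f v))
    (hK : ∀ i v, f (M.ρ (K i) v) = N.ρ (K i) (f v))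
    (hKinv : ∀ i v, f (M.ρ (Kinv i) v) = N.ρ (Kinv i) (f v)) :
    QRep.IsIntertwiner (res M) (res N) f := by
  rintro ⟨a, ha⟩
  change ∀ v, f (M.ρ a v) = N.ρ a (f v)
  induction ha using Algebra.adjoin_induction with
  | mem a ha =>
    obtain ((⟨i, rfl⟩ | ⟨i, rfl⟩) | ⟨i, rfl⟩) | ⟨i, rfl⟩ := ha
    exacts [hE i, hF i, hK i, hKinv i]
  | algebraMap c => intro v; simp only [AlgHom.commutes, Module.algebraMap_end_apply, map_smul]
  | add a b _ _ ha hb => intro v; simp only [map_add, LinearMap.add_apply, ha, hb]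
  | mul a b _ _ ha hb => intro v; simp only [map_mul, Module.End.mul_apply, ha, hb]

/-- A homomorphism `f` induces a homomorphism `id ⊗ f`. -/
theorem ρ_lTensor (M : QRep (Uqgl r)) {N N' : QRep (Uqgl r)} {f : N →ₗ[Cq] N'}
    (hf : QRep.IsIntertwiner N N' f) :
    QRep.IsIntertwiner (tensor M N) (tensor M N') (f.lTensor M) := by
  intro a z
  change f.lTensor M (Module.endTensorEndAlgHom
      (R := Cq) (S := Cq) (A := Cq) (Algebra.TensorProduct.map M.ρ N.ρ (comul r a)) z) =
    Module.endTensorEndAlgHom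
      (R := Cq) (S := Cq) (A := Cq) (Algebra.TensorProduct.map M.ρ N'.ρ (comul r a))
        (f.lTensor M z)
  -- No property of $\Delta$ enters: the identity holds for any element of $U \otimes U$ in place of
  -- $\Delta(a)$.
  induction comul r a using TensorProduct.induction_on with
  | zero => simp only [map_zero, LinearMap.zero_apply]
  | add u v hu hv => simp only [map_add, LinearMap.add_apply, hu, hv]
  | tmul u v =>
    induction z using TensorProduct.induction_on with
    | zero => simp only [map_zero]
    | add y z hy hz => simp only [map_add, hy, hz]
    | tmul m n =>
      rw [Algebra.TensorProduct.map_tmul, Algebra.TensorProduct.map_tmul]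
      exact congrArg (M.ρ u m ⊗ₜ[Cq] ·) (hf v n)

/-- Composed with the surjection $V \otimes V^{\otimes l} \to V \otimes \bigwedge_q^l(V)$, the map
$p$ becomes the quotient map of $V^{\otimes(l+1)}$. Both of these are equivariant, for all of
$U_q(\mathfrak{gl}_m)$. -/
theorem wedgeProj_isIntertwiner (l : ℕ) :
    QRep.IsIntertwiner (tensor (vec r) (wedge r l)) (wedge r (l + 1)) (wedgeProj r l) := by
  intro a z
  have h (y : vec r ⊗[Cq] tensorPow r l) : wedgeProj r l ((wedgeRel r l).mkQ.lTensor (vec r) y) =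
      (wedgeRel r (l + 1)).mkQ (tensorCons r l y) := by
    induction y using TensorProduct.induction_on with
    | zero => simp only [map_zero]
    | add u v hu hv => simp only [map_add, hu, hv]
    | tmul v t => rfl
  obtain ⟨y, rfl⟩ := LinearMap.lTensor_surjective (vec r) (wedgeRel r l).mkQ_surjective z
  rw [← ρ_lTensor (N := tensorPow r l) (N' := wedge r l) (vec r) (fun _ _ => rfl) a y, h, h]
  rfl

theorem dual_K (M : QRep (Uqgl r)) (i : Fin r) (f : Module.Dual Cq M) (v : M) :
    (dual M).ρ (K i) f v = f (M.ρ (Kinv i) v) := by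
  have h : (antipode r (K i)).unop = Kinv i := by
    simp only [K, antipode, map_mul, lift_gen, genMap, MulOpposite.unop_mul, MulOpposite.unop_op]
    exact (L_Linv_comm _ _).eq
  change f (M.ρ (antipode r (K i)).unop v) = _
  rw [h]

theorem dual_Kinv (M : QRep (Uqgl r)) (i : Fin r) (f : Module.Dual Cq M) (v : M) :
    (dual M).ρ (Kinv i) f v = f (M.ρ (K i) v) := by
  have h : (antipode r (Kinv i)).unop = K i := by
    simp only [Kinv, antipode, map_mul, lift_gen, genMap, MulOpposite.unop_mul,
      MulOpposite.unop_op]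
    exact (L_Linv_comm _ _).symm.eq
  change f (M.ρ (antipode r (Kinv i)).unop v) = _
  rw [h]

theorem dual_E (M : QRep (Uqgl r)) (i : Fin r) (f : Module.Dual Cq M) (v : M) :
    (dual M).ρ (E i) f v = -f (M.ρ (E i) (M.ρ (K i) v)) := by
  have h : (antipode r (E i)).unop = -(E i * K i) := by
    simp only [antipode, lift_gen, genMap, MulOpposite.unop_op]
  change f (M.ρ (antipode r (E i)).unop v) = _
  rw [h, map_neg, map_mul, LinearMap.neg_apply, map_neg, Module.End.mul_apply]

theorem dual_F (M : QRep (Uqgl r)) (i : Fin r) (f : Module.Dual Cq M) (v : M) :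
    (dual M).ρ (F i) f v = -f (M.ρ (Kinv i) (M.ρ (F i) v)) := by
  have h : (antipode r (F i)).unop = -(Kinv i * F i) := by
    simp only [antipode, lift_gen, genMap, MulOpposite.unop_op]
  change f (M.ρ (antipode r (F i)).unop v) = _
  rw [h, map_neg, map_mul, LinearMap.neg_apply, map_neg, Module.End.mul_apply]

/-! ### Invariant pairings -/

theorem K_Kinv_apply (M : QRep (Uqgl r)) (i : Fin r) (m : M) : M.ρ (K i) (M.ρ (Kinv i) m) = m := by
  rw [← Module.End.mul_apply, ← map_mul, K_mul_Kinv, map_one, Module.End.one_apply]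

theorem Kinv_K_apply (M : QRep (Uqgl r)) (i : Fin r) (m : M) : M.ρ (Kinv i) (M.ρ (K i) m) = m := by
  rw [← Module.End.mul_apply, ← map_mul, Kinv_mul_K, map_one, Module.End.one_apply]

section pairing

variable {M N : QRep (Uqgl r)} {β : tensor M N →ₗ[Cq] triv r}

/-- This and the next three lemmas move a generator from the second slot to the first. Since $K_i$
is group-like with counit $1$, invariance at $K_i^{-1}m \otimes n$ suffices here. -/
theorem pairing_K (hβ : QRep.IsIntertwiner (res (tensor M N)) (res (triv r)) β) (i : Fin r)
    (m : M) (n : N) : β (m ⊗ₜ N.ρ (K i) n) = β (M.ρ (Kinv i) m ⊗ₜ n) := by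
  have h : β ((tensor M N).ρ (K i) (M.ρ (Kinv i) m ⊗ₜ n)) = (triv r).ρ (K i) _ :=
    hβ ⟨K i, K_mem i⟩ _
  rwa [tensor_K, triv_K, K_Kinv_apply] at h

theorem pairing_Kinv (hβ : QRep.IsIntertwiner (res (tensor M N)) (res (triv r)) β) (i : Fin r)
    (m : M) (n : N) : β (m ⊗ₜ N.ρ (Kinv i) n) = β (M.ρ (K i) m ⊗ₜ n) := by
  have h : β ((tensor M N).ρ (Kinv i) (M.ρ (K i) m ⊗ₜ n)) = (triv r).ρ (Kinv i) _ :=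
    hβ ⟨Kinv i, Kinv_mem i⟩ _
  rwa [tensor_Kinv, triv_Kinv, Kinv_K_apply] at h

/-- The counit kills $E_i$, so the two terms of $\Delta(E_i)$ cancel under `β`. A $K_i^{-1}$ remains
in the second slot. -/
theorem pairing_E (hβ : QRep.IsIntertwiner (res (tensor M N)) (res (triv r)) β) (i : Fin r)
    (m : M) (n : N) : β (m ⊗ₜ N.ρ (E i) n) = -β (M.ρ (E i) m ⊗ₜ N.ρ (Kinv i) n) := by
  have h : β ((tensor M N).ρ (E i) (m ⊗ₜ n)) = (triv r).ρ (E i) _ := hβ ⟨E i, E_mem i⟩ _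
  rw [tensor_E, triv_E, map_add] at h
  exact eq_neg_of_add_eq_zero_right h

/-- Invariance is applied at $K_i^{-1}m \otimes n$, so that the factor $K_i$ in $K_i \otimes F_i$
disappears. -/
theorem pairing_F (hβ : QRep.IsIntertwiner (res (tensor M N)) (res (triv r)) β) (i : Fin r)
    (m : M) (n : N) : β (m ⊗ₜ N.ρ (F i) n) = -β (M.ρ (F i) (M.ρ (Kinv i) m) ⊗ₜ n) := by
  have h : β ((tensor M N).ρ (F i) (M.ρ (Kinv i) m ⊗ₜ n)) = (triv r).ρ (F i) _ :=
    hβ ⟨F i, F_mem i⟩ _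
  rw [tensor_F, triv_F, map_add, K_Kinv_apply] at h
  exact eq_neg_of_add_eq_zero_right h

/-- An invariant pairing `M ⊗ N → ℂ_q` gives a homomorphism `M → N*`. -/
theorem curry_isIntertwiner (hβ : QRep.IsIntertwiner (res (tensor M N)) (res (triv r)) β) :
    QRep.IsIntertwiner (res M) (res (dual N)) (TensorProduct.curry β) := by
  refine isIntertwiner_res (N := dual N) _ ?_ ?_ ?_ ?_ <;> intro i m <;>
    refine LinearMap.ext fun n => ?_
  · rw [dual_E]
    change β _ = -β (m ⊗ₜ _)
    -- The $K_i$ of $S(E_i) = -E_iK_i$ absorbs the $K_i^{-1}$ left by the coproduct.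
    rw [pairing_E hβ, Kinv_K_apply, neg_neg]
    rfl
  · rw [dual_F]
    change β _ = -β (m ⊗ₜ _)
    rw [pairing_Kinv hβ, pairing_F hβ, Kinv_K_apply, neg_neg]
    rfl
  · rw [dual_K]
    exact (pairing_Kinv hβ i m n).symm
  · rw [dual_Kinv]
    exact (pairing_K hβ i m n).symm

/-- A linear map that transports an invariant pairing to a nondegenerate invariant pairing is a
homomorphism. -/
theorem isIntertwiner_of_pairing {N' : QRep (Uqgl r)} {γ : tensor M N' →ₗ[Cq] triv r}
    (hβ : QRep.IsIntertwiner (res (tensor M N)) (res (triv r)) β)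
    (hγ : QRep.IsIntertwiner (res (tensor M N')) (res (triv r)) γ)
    (nondeg : ∀ f g : N', (∀ m, γ (m ⊗ₜ f) = γ (m ⊗ₜ g)) → f = g)
    {ψ : N →ₗ[Cq] N'} (h : ∀ m n, γ (m ⊗ₜ ψ n) = β (m ⊗ₜ n)) :
    QRep.IsIntertwiner (res N) (res N') ψ := by
  -- This case comes first because moving $E_i$ across the pairing leaves $K_i^{-1}$ on the second
  -- slot, which must then pass through `ψ`.
  have hKinv (i : Fin r) (n : N) : ψ (N.ρ (Kinv i) n) = N'.ρ (Kinv i) (ψ n) :=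
    nondeg _ _ fun m => by rw [h, pairing_Kinv hβ, pairing_Kinv hγ, h]
  refine isIntertwiner_res _ (fun i n => nondeg _ _ fun m => ?_)
    (fun i n => nondeg _ _ fun m => ?_) (fun i n => nondeg _ _ fun m => ?_) hKinv
  · rw [h, pairing_E hβ, pairing_E hγ, ← hKinv, h]
  · rw [h, pairing_F hβ, pairing_F hγ, h]
  · rw [h, pairing_K hβ, pairing_K hγ, h]

end pairing

/-! ### The pairing of `V` and its dual -/

/-- Linear maps on `V ⊗ N` that agree on the `x_k ⊗ n` are equal. -/
theorem tensor_vec_ext {N P : Type} [AddCommGroup N] [Module Cq N] [AddCommGroup P] [Module Cq P]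
    {f g : vec r ⊗[Cq] N →ₗ[Cq] P} (h : ∀ k n, f (x k ⊗ₜ n) = g (x k ⊗ₜ n)) : f = g := by
  refine TensorProduct.ext ((Pi.basisFun Cq (Fin (r + 1))).ext fun k => LinearMap.ext fun n => ?_)
  rw [Pi.basisFun_apply]
  exact h k n

theorem cap_nondegenerate (f g : Module.Dual Cq (vec r))
    (h : ∀ v, cap r (v ⊗ₜ f) = cap r (v ⊗ₜ g)) : f = g := by
  refine (Pi.basisFun Cq (Fin (r + 1))).ext fun k => ?_
  rw [Pi.basisFun_apply]
  have h1 := h (x k)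
  rw [cap_tmul, cap_tmul] at h1
  exact mul_left_cancel₀ (zpow_ne_zero _ q_ne_zero) h1

/-- Invariance under $E_i$ and $F_i$ forces consecutive coefficients of the pairing to have ratio
$q^2$, which the exponents $2k - r$ provide; their common shift is only a normalization. -/
theorem cap_isIntertwiner :
    QRep.IsIntertwiner (res (tensor (vec r) (dual (vec r)))) (res (triv r)) (cap r) := by
  have q0 := q_ne_zero
  refine isIntertwiner_res (M := tensor (vec r) (dual (vec r))) (N := triv r) (cap r)
      ?_ ?_ ?_ ?_ <;> intro i z <;>
    refine LinearMap.congr_fun (f := cap r ∘ₗ (tensor (vec r) (dual (vec r))).ρ _)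
      (g := (triv r).ρ _ ∘ₗ cap r) (tensor_vec_ext fun k f => ?_) z <;>
    have hne : i.castSucc ≠ i.succ := (Fin.castSucc_lt_succ).ne
  · rw [LinearMap.comp_apply, LinearMap.comp_apply, triv_E, tensor_E, map_add, E_x, cap_tmul,
      dual_E, K_x, map_smul, E_x]
    split_ifs with h1 h2
    · exact absurd (h2.symm.trans h1) hne
    -- For $k = i+1$ the two terms are $q^{2i-r}\,q\,f(x_i)$ and $-q^{2i+2-r}\,q^{-1}f(x_i)$.
    · subst h1
      rw [cap_tmul, dual_Kinv, K_x, if_neg hne, if_pos rfl, Fin.val_succ, Fin.val_castSucc]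
      simp only [one_mul, mul_one, map_smul, smul_eq_mul]
      push_cast
      rw [show (2 * ((i : ℤ) + 1) - r) = 2 * i - r + 1 + 1 by ring, zpow_add_one₀ q0,
        zpow_add_one₀ q0]
      field_simp
      ring
    · simp
    · simp
  · rw [LinearMap.comp_apply, LinearMap.comp_apply, triv_F, tensor_F, map_add, F_x, K_x,
      ← TensorProduct.smul_tmul', map_smul, cap_tmul, dual_F, F_x]
    split_ifs with h1 h2
    · exact absurd (h1.symm.trans h2) hne
    -- For $k = i$ the two terms are $q^{2i+2-r}f(x_{i+1})$ and $-q\,q^{2i-r}\,q\,f(x_{i+1})$.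
    · subst h1
      rw [cap_tmul, Kinv_x, if_neg hne.symm, if_pos rfl, Fin.val_succ, Fin.val_castSucc]
      simp only [one_mul, mul_one, map_smul, smul_eq_mul]
      push_cast
      rw [show (2 * ((i : ℤ) + 1) - r) = 2 * i - r + 1 + 1 by ring, zpow_add_one₀ q0,
        zpow_add_one₀ q0]
      field_simp
      ring
    · simp
    · simp
  · rw [LinearMap.comp_apply, LinearMap.comp_apply, triv_K, tensor_K, K_x,
      ← TensorProduct.smul_tmul', map_smul, cap_tmul, cap_tmul, dual_K, Kinv_x, map_smul]
    split_ifs <;> simp <;> field_simp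
  · rw [LinearMap.comp_apply, LinearMap.comp_apply, triv_Kinv, tensor_Kinv, Kinv_x,
      ← TensorProduct.smul_tmul', map_smul, cap_tmul, cap_tmul, dual_Kinv, K_x, map_smul]
    split_ifs <;> simp <;> field_simp

/-! ### The top quantum exterior power -/

/-- Since $L_j$ is group-like, its eigenvalues multiply along the product, and $x_j$ occurs at most
once. -/
theorem L_wedgeMon (j : Fin (r + 1)) (l : ℕ) (S : Finset (Fin (r + 1))) (hS : S.card = l) :
    (wedge r l).ρ (L j) (wedgeMon l S) = (if j ∈ S then q else 1) • wedgeMon l S := by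
  induction l generalizing S with
  | zero =>
    obtain rfl := Finset.card_eq_zero.1 hS
    have h : (triv r).ρ (L j) 1 = 1 := by simp [counit, lift_gen, genMap]
    rw [if_neg (Finset.notMem_empty j), one_smul]
    exact congrArg (wedgeRel r 0).mkQ h
  | succ l ih =>
    obtain ⟨a, T, hT, ha, rfl⟩ := exists_insert_min hS
    have haT : a ∉ T := fun h => (ha a h).false
    rw [wedgeMon_insert l a T ha, ← wedgeProj_isIntertwiner, tensor_L, L_x, ih T hT,
      TensorProduct.smul_tmul_smul, map_smul]
    congr 1
    by_cases h : j = a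
    · subst h; simp [haT]
    · simp [h, Ne.symm h]

/-- The generator `x_1 ⋯ x_m` of `⋀_q^m(V)`. -/
def wedgeTop (r : ℕ) : wedge r (r + 1) := wedgeMon (r + 1) Finset.univ

theorem exists_eq_smul_wedgeTop (w : wedge r (r + 1)) : ∃ c : Cq, c • wedgeTop r = w := by
  refine Submodule.mem_span_singleton.1 (wedge_induction (fun S hS => ?_) w)
  rw [(Finset.card_eq_iff_eq_univ S).1 (by simpa using hS)]
  exact Submodule.mem_span_singleton_self _

theorem wedgeTop_ne_zero : wedgeTop r ≠ 0 := wedgeMon_ne_zero (by simp)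

/-- All $L_j$ have the same eigenvalue, so the quotients $L_iL_{i+1}^{-1}$ act trivially. As $q \ne
1$, the line is trivial for $U_q(\mathfrak{sl}_m)$ but not for $U_q(\mathfrak{gl}_m)$. -/
theorem L_wedgeTop (j : Fin (r + 1)) (w : wedge r (r + 1)) :
    (wedge r (r + 1)).ρ (L j) w = q • w := by
  obtain ⟨c, rfl⟩ := exists_eq_smul_wedgeTop w
  rw [map_smul, wedgeTop, L_wedgeMon j _ _ (by simp), if_pos (Finset.mem_univ j), smul_comm]

theorem Linv_wedgeTop (j : Fin (r + 1)) (w : wedge r (r + 1)) :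
    (wedge r (r + 1)).ρ (Linv j) w = q⁻¹ • w := by
  have h : (wedge r (r + 1)).ρ (Linv j) ((wedge r (r + 1)).ρ (L j) (q⁻¹ • w)) = q⁻¹ • w := by
    rw [← Module.End.mul_apply, ← map_mul, Linv_mul_L, map_one, Module.End.one_apply]
  rwa [L_wedgeTop, smul_smul, mul_inv_cancel₀ q_ne_zero, one_smul] at h

/-- An element of `U_q(gl_m)` of nonzero weight annihilates `⋀_q^m(V)`. -/
theorem wedgeTop_eq_zero_of_weight {a : Uqgl r} {j : Fin (r + 1)} {c : Cq} (hc : c ≠ 1)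
    (h : L j * a = c • (a * L j)) (w : wedge r (r + 1)) : (wedge r (r + 1)).ρ a w = 0 := by
  have h1 := congrArg (fun b => (wedge r (r + 1)).ρ b w) h
  simp only [map_mul, map_smul, Module.End.mul_apply, LinearMap.smul_apply] at h1
  rw [L_wedgeTop, L_wedgeTop, map_smul, smul_comm] at h1
  -- Cancelling the eigenvalue $q$ leaves $aw = c\,aw$ with $c \ne 1$.
  have h2 := smul_right_injective _ q_ne_zero h1
  by_contra h3
  exact hc (smul_left_injective Cq h3 (by simpa using h2.symm))

theorem q_ne_one : q ≠ 1 := by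
  intro h
  have h1 := q_sub_ne_zero
  simp [h] at h1

theorem E_wedgeTop (i : Fin r) (w : wedge r (r + 1)) : (wedge r (r + 1)).ρ (E i) w = 0 :=
  wedgeTop_eq_zero_of_weight (c := q) (j := i.castSucc) q_ne_one (by rw [L_E]; simp [wt]) w

theorem F_wedgeTop (i : Fin r) (w : wedge r (r + 1)) : (wedge r (r + 1)).ρ (F i) w = 0 :=
  wedgeTop_eq_zero_of_weight (c := q⁻¹) (j := i.castSucc) (inv_ne_one.2 q_ne_one)
    (by rw [L_F]; simp [wt]) w

/-- A linear form on the top quantum exterior power is `U_q(sl_m)`-invariant. -/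
theorem isIntertwiner_wedgeTop (f : wedge r (r + 1) →ₗ[Cq] triv r) :
    QRep.IsIntertwiner (res (wedge r (r + 1))) (res (triv r)) f := by
  have q0 := q_ne_zero
  refine isIntertwiner_res f ?_ ?_ ?_ ?_ <;> intro i w
  · rw [E_wedgeTop, triv_E, map_zero]
  · rw [F_wedgeTop, triv_F, map_zero]
  · rw [triv_K, K, map_mul, Module.End.mul_apply, Linv_wedgeTop, L_wedgeTop, smul_smul,
      mul_inv_cancel₀ q0, one_smul]
  · rw [triv_Kinv, Kinv, map_mul, Module.End.mul_apply, Linv_wedgeTop, L_wedgeTop, smul_smul,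
      inv_mul_cancel₀ q0, one_smul]

/-- The isomorphism `⋀_q^m(V) ≃ ℂ_q` that sends `x_1 ⋯ x_m` to `1`. -/
def wedgeTopIso (r : ℕ) : QRep.Iso (res (wedge r (r + 1))) (res (triv r)) where
  toEquiv := (LinearEquiv.ofBijective (LinearMap.toSpanSingleton Cq _ (wedgeTop r))
    ⟨smul_left_injective Cq wedgeTop_ne_zero, exists_eq_smul_wedgeTop⟩).symm
  isIntertwiner := isIntertwiner_wedgeTop _

/-! ### The duality between `V` and `⋀_q^{m-1}(V)` -/

/-- The basis of `⋀_q^{m-1}(V)` dual to the basis of `V`, as a map from coordinate vectors. -/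
def dualMon (r : ℕ) : (Fin (r + 1) → Cq) →ₗ[Cq] wedge r r :=
  Fintype.linearCombination Cq fun k =>
    -- The scalar undoes the power of $-q$ produced by sorting $x_k$ into the monomial that omits
    -- it.
    ((-q) ^ below k (Finset.univ.erase k))⁻¹ • wedgeMon r (Finset.univ.erase k)

theorem card_univ_erase (k : Fin (r + 1)) : (Finset.univ.erase k).card = r := by simp

/-- For $j \ne k$ the vector $x_j$ already occurs in the monomial omitting $x_k$, so the product is
$0$; for $j = k$ the normalization makes it the top monomial. -/
theorem wedgeProj_dualMon (v : vec r) (c : Fin (r + 1) → Cq) :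
    wedgeProj r r (v ⊗ₜ dualMon r c) = (v ⬝ᵥ c) • wedgeTop r := by
  have q0 : -q ≠ 0 := neg_ne_zero.2 q_ne_zero
  have h (j k : Fin (r + 1)) : wedgeProj r r (x j ⊗ₜ wedgeMon r (Finset.univ.erase k)) =
      if j = k then (-q) ^ below k (Finset.univ.erase k) • wedgeTop r else 0 := by
    rw [wedgeProj_wedgeMon r j _ (card_univ_erase k)]
    by_cases hjk : j = k
    · subst hjk
      simp [wedgeTop]
    · simp [hjk]
  have hv : v = ∑ j, v j • x j := by
    ext k
    simp [x, Finset.sum_apply, Pi.single_apply]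
  conv_lhs => rw [hv]
  simp only [dualMon, Fintype.linearCombination_apply, TensorProduct.sum_tmul,
    TensorProduct.tmul_sum, map_sum, ← TensorProduct.smul_tmul', TensorProduct.tmul_smul, map_smul,
    h, dotProduct, Finset.sum_smul]
  refine Finset.sum_congr rfl fun j _ => ?_
  rw [Finset.sum_eq_single j (fun k _ hk => by simp [hk]) (by simp), if_pos rfl,
    smul_comm (v j), inv_smul_smul₀ (pow_ne_zero _ q0), smul_smul, mul_comm]

theorem dualMon_surjective : Function.Surjective (dualMon r) := by
  rw [← LinearMap.range_eq_top, eq_top_iff]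
  rintro w -
  refine wedge_induction (fun S hS => ?_) w
  obtain ⟨k, rfl⟩ : ∃ k, S = Finset.univ.erase k := by
    have h : Sᶜ.card = 1 := by rw [Finset.card_compl, hS, Fintype.card_fin]; omega
    obtain ⟨k, hk⟩ := Finset.card_eq_one.1 h
    exact ⟨k, by rw [← compl_compl S, hk, Finset.compl_singleton]⟩
  refine ⟨Pi.single k ((-q) ^ below k (Finset.univ.erase k)), ?_⟩
  rw [dualMon, Fintype.linearCombination_apply_single,
    smul_inv_smul₀ (pow_ne_zero _ (neg_ne_zero.2 q_ne_zero))]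

section duality

variable (φ : wedge r (r + 1) ≃ₗ[Cq] triv r)

/-- The pairing `V ⊗ ⋀_q^{m-1}(V) → ⋀_q^m(V) ≃ ℂ_q`. -/
def wedgePairing : tensor (vec r) (wedge r r) →ₗ[Cq] triv r :=
  φ.toLinearMap ∘ₗ wedgeProj r r

theorem wedgePairing_dualMon (v : vec r) (c : Fin (r + 1) → Cq) :
    wedgePairing φ (v ⊗ₜ dualMon r c) = (v ⬝ᵥ c) * φ (wedgeTop r) := by
  change φ (wedgeProj r r (v ⊗ₜ dualMon r c)) = _
  rw [wedgeProj_dualMon, map_smul]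
  rfl

theorem apply_wedgeTop_ne_zero : φ (wedgeTop r) ≠ 0 :=
  φ.map_ne_zero_iff.2 wedgeTop_ne_zero

/-- Linearity of `φ` is enough, since every linear form on the top power is invariant. -/
theorem wedgePairing_isIntertwiner :
    QRep.IsIntertwiner (res (tensor (vec r) (wedge r r))) (res (triv r)) (wedgePairing φ) :=
  fun a z => (congrArg φ (wedgeProj_isIntertwiner r a.1 z)).trans
    (isIntertwiner_wedgeTop φ.toLinearMap a _)

theorem curry_wedgePairing_bijective :
    Function.Bijective (TensorProduct.curry (wedgePairing φ)) := by
  have h0 := apply_wedgeTop_ne_zero φ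
  constructor
  · refine (injective_iff_map_eq_zero _).2 fun v hv => funext fun k => ?_
    have h : wedgePairing φ (v ⊗ₜ dualMon r (Pi.single k 1)) = 0 := LinearMap.congr_fun hv _
    rw [wedgePairing_dualMon, dotProduct_single_one] at h
    exact (mul_eq_zero.1 h).resolve_right h0
  · intro g
    -- The coordinates of the preimage are forced by evaluating `g` on the dual monomials, up to the
    -- scalar by which the pairing differs from the dot product.
    refine ⟨fun k => g (dualMon r (Pi.single k 1)) / φ (wedgeTop r), LinearMap.ext fun w => ?_⟩
    obtain ⟨c, rfl⟩ := dualMon_surjective w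
    refine (wedgePairing_dualMon φ _ c).trans ?_
    conv_rhs => rw [pi_eq_sum_univ' c]
    rw [dotProduct, Finset.sum_mul, map_sum, map_sum]
    refine Finset.sum_congr rfl fun k _ => ?_
    rw [map_smul, map_smul, smul_eq_mul, mul_right_comm, div_mul_cancel₀ _ h0, mul_comm]

/-- The map `⋀_q^{m-1}(V) → V*` adjoint to the pairing, normalized by `cap`. -/
def wedgeDual : wedge r r →ₗ[Cq] Module.Dual Cq (vec r) :=
  ∑ k : Fin (r + 1), q ^ (-(2 * (k : ℤ) - r)) •
    (TensorProduct.curry (wedgePairing φ) (x k)).smulRight (LinearMap.proj k : vec r →ₗ[Cq] Cq)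

theorem wedgeDual_x (w : wedge r r) (k : Fin (r + 1)) :
    wedgeDual φ w (x k) = q ^ (-(2 * (k : ℤ) - r)) * wedgePairing φ (x k ⊗ₜ w) := by
  simp [wedgeDual, x, Pi.single_apply]

/-- The powers of $q$ in `wedgeDual` are the inverses of those in `cap`. As `cap` is nondegenerate,
this identity determines `wedgeDual φ` and yields its equivariance. -/
theorem cap_wedgeDual (v : vec r) (w : wedge r r) :
    cap r (v ⊗ₜ wedgeDual φ w) = wedgePairing φ (v ⊗ₜ w) := by
  refine LinearMap.congr_fun (f := cap r ∘ₗ (wedgeDual φ).lTensor (vec r))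
    (tensor_vec_ext fun k w => ?_) (v ⊗ₜ w)
  rw [LinearMap.comp_apply, LinearMap.lTensor_tmul, cap_tmul, wedgeDual_x, ← mul_assoc,
    ← zpow_add₀ q_ne_zero, add_neg_cancel, zpow_zero, one_mul]

theorem wedgeDual_bijective : Function.Bijective (wedgeDual φ) := by
  have h0 := apply_wedgeTop_ne_zero φ
  constructor
  · refine (injective_iff_map_eq_zero _).2 fun w hw => ?_
    obtain ⟨c, rfl⟩ := dualMon_surjective w
    suffices h : c = 0 by rw [h, map_zero]
    funext k
    have h1 := cap_wedgeDual φ (x k) (dualMon r c)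
    rw [hw, TensorProduct.tmul_zero, map_zero, wedgePairing_dualMon, x, single_one_dotProduct]
      at h1
    exact (mul_eq_zero.1 h1.symm).resolve_right h0
  · intro f
    -- The $k$-th coordinate solves $\mathrm{cap}(x_k \otimes f) = c_k\,\varphi(x_1\cdots x_m)$.
    refine ⟨dualMon r fun k => q ^ (2 * (k : ℤ) - r) * f (x k) / φ (wedgeTop r),
      (Pi.basisFun Cq (Fin (r + 1))).ext fun k => ?_⟩
    rw [Pi.basisFun_apply]
    refine (wedgeDual_x φ _ k).trans ?_
    rw [wedgePairing_dualMon, x, single_one_dotProduct, div_mul_cancel₀ _ h0, ← mul_assoc,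
      ← zpow_add₀ q_ne_zero, neg_add_cancel, zpow_zero, one_mul]
    rfl

/-- The isomorphism `V ≃ (⋀_q^{m-1}(V))*` given by the pairing. -/
def vecIso : QRep.Iso (res (vec r)) (res (dual (wedge r r))) where
  toEquiv := LinearEquiv.ofBijective _ (curry_wedgePairing_bijective φ)
  isIntertwiner := curry_isIntertwiner (wedgePairing_isIntertwiner φ)

/-- The isomorphism `⋀_q^{m-1}(V) ≃ V*` given by the pairing. -/
def wedgeIso : QRep.Iso (res (wedge r r)) (res (dual (vec r))) where
  toEquiv := LinearEquiv.ofBijective _ (wedgeDual_bijective φ)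
  isIntertwiner := isIntertwiner_of_pairing (N' := dual (vec r)) (wedgePairing_isIntertwiner φ)
    cap_isIntertwiner cap_nondegenerate (cap_wedgeDual φ)

end duality

end QuantumGl

end

theorem mainTheorem3 (r : ℕ) :
    Nonempty (QuantumGl.QRep.Iso (QuantumGl.res (QuantumGl.wedge r (r + 1)))
      (QuantumGl.res (QuantumGl.triv r))) ∧
    Nonempty (QuantumGl.QRep.Iso (QuantumGl.res (QuantumGl.wedge r r))
      (QuantumGl.res (QuantumGl.dual (QuantumGl.vec r)))) ∧
    QuantumGl.QRep.IsIntertwiner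
      (QuantumGl.res (QuantumGl.tensor (QuantumGl.vec r) (QuantumGl.wedge r r)))
      (QuantumGl.res (QuantumGl.wedge r (r + 1))) (QuantumGl.wedgeProj r r) ∧
    Function.Surjective (QuantumGl.wedgeProj r r) ∧
    ∀ φ : QuantumGl.QRep.Iso (QuantumGl.res (QuantumGl.wedge r (r + 1)))
        (QuantumGl.res (QuantumGl.triv r)),
      (∃ θ : QuantumGl.QRep.Iso (QuantumGl.res (QuantumGl.vec r))
          (QuantumGl.res (QuantumGl.dual (QuantumGl.wedge r r))),
        ∀ (v : QuantumGl.vec r) (w : QuantumGl.wedge r r),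
          θ.toEquiv v w = φ.toEquiv (QuantumGl.wedgeProj r r (v ⊗ₜ[QuantumGl.Cq] w))) ∧
      (∃ ψ : QuantumGl.QRep.Iso (QuantumGl.res (QuantumGl.wedge r r))
          (QuantumGl.res (QuantumGl.dual (QuantumGl.vec r))),
        ∀ (v : QuantumGl.vec r) (w : QuantumGl.wedge r r),
          QuantumGl.cap r (v ⊗ₜ[QuantumGl.Cq] ψ.toEquiv w) =
            φ.toEquiv (QuantumGl.wedgeProj r r (v ⊗ₜ[QuantumGl.Cq] w))) := by
  -- Here $m = r + 1$. The bare isomorphism $\bigwedge_q^{m-1}(V) \simeq V^*$ is the one attached to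
  -- the particular $\varphi$ sending $x_1\cdots x_m$ to $1$.
  refine ⟨⟨QuantumGl.wedgeTopIso r⟩, ⟨QuantumGl.wedgeIso (QuantumGl.wedgeTopIso r).toEquiv⟩,
    fun a => QuantumGl.wedgeProj_isIntertwiner r a.1, QuantumGl.wedgeProj_surjective r,
    fun φ => ⟨⟨QuantumGl.vecIso φ.toEquiv, fun _ _ => rfl⟩,
      ⟨QuantumGl.wedgeIso φ.toEquiv, QuantumGl.cap_wedgeDual φ.toEquiv⟩⟩⟩
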